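/- Let $\mathbb{K}$ be an algebraically closed field of characteristic zero, let $$X = V(z_1z_3 - z_2z_4) \subset \mathbb{K}^4,$$ and let the two-dimensional torus $T = \mathbb{K}^*\times\mathbb{K}^*$ act on $X$ by $$t\cdot x = (t_1^2x_1,\; t_1t_2^2x_2,\; t_1t_2x_3,\; t_1^2t_2^{-1}x_4).$$ Let $U = X_{z_2z_3}\cup X_{z_1z_4}\subset X$ be the $T$-invariant open set of all points with $x_2x_3\neq 0$ or $x_1x_4\neq 0$. Then: (i) $U$ has a geometric quotient $U\to U/T$ with $U/T\cong\mathbb{P}_1$. Here a geometric quotient is an affine $T$-invariant morphism $p\colon U\to Y$ such that the canonical map $\mathcal{O}_Y\to p_*(\mathcal{O}_U)^T$ is an isomorphism and the fibres of $p$ over closed points are precisely the $T$-orbits. (ii) There is no $T$-linearized line bundle $L$ on $X$ such that $U$ is the set $X^{ss}(L)$ of semistable points of $L$ in the sense of Mumford. Here a $T$-linearized line bundle is a line bundle with a $T$-action on its total space that makes the projection equivariant and is linear on the fibres, and a point $x\in X$ is semistable with respect to $L$ if for some $n>0$ there is a $T$-invariant section $s$ of $L^{\otimes n}$ (with the induced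 linearization) such that $X_s=\{s\ne 0\}$ is affine and contains $x$. -/

import Mathlib

universe u

open CategoryTheory MonoidalCategory CartesianMonoidalCategory AlgebraicGeometry MonObj
open scoped TensorProduct

noncomputable section

namespace ConeGIT

/-! ### Schemes over a field -/

/-- Schemes over the field `K`. The monoidal structure on this category is the fibre product over
`Spec K`, and its unit `𝟙_ (KScheme K)` is `Spec K`. A `K`-point of `X` is a morphism
`𝟙_ (KScheme K) ⟶ X`. -/
abbrev KScheme (K : Type u) [Field K] : Type (u + 1) := Over (Spec (CommRingCat.of K))

/-- The affine `K`-scheme `Spec A` of a commutative `K`-algebra `A`. If `A` is a bialgebra, Mathlib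
makes `Spec A` a monoid object. -/
abbrev affineScheme (K : Type u) [Field K] (A : Type u) [CommRing A] [Algebra K A] : KScheme K :=
  (Spec (CommRingCat.of A)).asOver (Spec (CommRingCat.of K))

/-- The morphism of affine `K`-schemes given by a homomorphism of `K`-algebras. -/
def affineMap (K : Type u) [Field K] {A B : Type u} [CommRing A] [CommRing B] [Algebra K A]
    [Algebra K B] (φ : A →ₐ[K] B) : affineScheme K B ⟶ affineScheme K A :=
  (Spec.map (CommRingCat.ofHom φ.toRingHom)).asOver (Spec (CommRingCat.of K))

/-- The canonical (iso)morphism `Spec A × Spec B ⟶ Spec (A ⊗ B)`. -/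
def prodToSpec (K : Type u) [Field K] (A B : Type u) [CommRing A] [CommRing B] [Algebra K A]
    [Algebra K B] : affineScheme K A ⊗ affineScheme K B ⟶ affineScheme K (A ⊗[K] B) :=
  Over.homMk (pullbackSpecIso K A B).hom (pullbackSpecIso_hom_base K A B)

/-- The affine line with its multiplicative monoid structure: the spectrum of the monoid algebra
`K[ℕ]`, that is, of the polynomial ring in a coordinate `x` with comultiplication
`x ↦ x ⊗ x`. -/
abbrev affineLine (K : Type u) [Field K] : KScheme K := affineScheme K (AddMonoidAlgebra K ℕ)

/-- The origin of the affine line. -/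
def origin (K : Type u) [Field K] : 𝟙_ (KScheme K) ⟶ affineLine K :=
  Over.homMk (Spec.map (CommRingCat.ofHom
    (AddMonoidAlgebra.lift K K ℕ (powersHom K (0 : K))).toRingHom)) (by
      have h : CommRingCat.ofHom (algebraMap K (AddMonoidAlgebra K ℕ)) ≫ CommRingCat.ofHom
          (AddMonoidAlgebra.lift K K ℕ (powersHom K (0 : K))).toRingHom = 𝟙 _ := by
        ext r
        exact (AddMonoidAlgebra.lift K K ℕ (powersHom K (0 : K))).commutes r
      refine (Spec.map_comp _ _).symm.trans ?_
      rw [h]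
      exact Spec.map_id _)

/-- The two-dimensional torus `𝔾ₘ × 𝔾ₘ`: the spectrum of the group algebra `K[ℤ × ℤ]`; the
coordinates `t₁`, `t₂` are the basis elements at `(1, 0)` and `(0, 1)`. -/
abbrev torus (K : Type u) [Field K] : KScheme K := affineScheme K (AddMonoidAlgebra K (ℤ × ℤ))

section
attribute [local instance] MvPolynomial.gradedAlgebra

/-- The projective line `Proj K[x₀, x₁]` over `K`. -/
def projectiveLine (K : Type u) [Field K] : KScheme K :=
  Over.mk (Proj.toSpecZero (MvPolynomial.homogeneousSubmodule (Fin 2) K) ≫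
    Spec.map (CommRingCat.ofHom
      (algebraMap K (MvPolynomial.homogeneousSubmodule (Fin 2) K 0))))

end

section General

variable {K : Type u} [Field K]

/-- An open subset of a `K`-scheme as a `K`-scheme. -/
def openSub (X : KScheme K) (V : X.left.Opens) : KScheme K := Over.mk (V.ι ≫ X.hom)

/-- The inclusion of an open subscheme. -/
def openIncl (X : KScheme K) (V : X.left.Opens) : openSub X V ⟶ X := Over.homMk V.ι

/-- The action morphism `(g, x) ↦ g • x`. -/
abbrev act (G X : KScheme K) [MonObj G] [ModObj G X] : G ⊗ X ⟶ X := γ[G, X]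

/-! ### Good and geometric quotients -/

/-- The function `f` on the open set `W` of the `G`-scheme `X` is `G`-invariant: its pullbacks along
`(g, x) ↦ g • x` and `(g, x) ↦ x` agree (wherever both are defined, which is everywhere on `G × W`
if `W` is `G`-invariant). -/
def IsInvariantFunction (G X : KScheme K) [MonObj G] [ModObj G X] {W : X.left.Opens}
    (f : Γ(X.left, W)) : Prop :=
  (act G X).left.app W f |_ (((act G X).left ⁻¹ᵁ W) ⊓ ((snd G X).left ⁻¹ᵁ W)) =
    (snd G X).left.app W f |_ (((act G X).left ⁻¹ᵁ W) ⊓ ((snd G X).left ⁻¹ᵁ W))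

/-- A good quotient: an affine `G`-invariant morphism `p : X ⟶ Y` such that the canonical map from
`𝒪_Y` to the sheaf of invariants `(p_* 𝒪_X)^G` is an isomorphism. -/
structure IsGoodQuotient (G : KScheme K) [MonObj G] {X Y : KScheme K} [ModObj G X]
    (p : X ⟶ Y) : Prop where
  isAffineHom : IsAffineHom p.left
  invariant : act G X ≫ p = snd G X ≫ p
  injective (V : Y.left.Opens) : Function.Injective (p.left.app V)
  mem_range_iff (V : Y.left.Opens) (f : Γ(X.left, p.left ⁻¹ᵁ V)) :
    f ∈ Set.range (p.left.app V) ↔ IsInvariantFunction G X f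

/-- A geometric quotient: a good quotient whose fibres (over `K`-points) are precisely the
`G`-orbits. -/
structure IsGeometricQuotient (G : KScheme K) [MonObj G] {X Y : KScheme K} [ModObj G X]
    (p : X ⟶ Y) : Prop extends IsGoodQuotient G p where
  fibre_eq_orbit (y : 𝟙_ (KScheme K) ⟶ Y) : ∃ x : 𝟙_ (KScheme K) ⟶ X,
    ∀ x' : 𝟙_ (KScheme K) ⟶ X,
      x' ≫ p = y ↔ ∃ g : 𝟙_ (KScheme K) ⟶ G, x' = lift g x ≫ act G X

/-! ### Linearized line bundles and semistable points -/

/-- A (geometric) line bundle on `X`: a scheme over `X` with a scalar multiplication by the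
multiplicative monoid of the affine line that over the members of an open cover of `X` is isomorphic
to the trivial bundle `𝔸¹ × V`. An isomorphism between trivial bundles that respects scalar
multiplication is multiplication by an invertible function, so that the linear structure of the
fibres is determined by the scalar multiplication. -/
structure LineBundle (X : KScheme K) where
  /-- The total space. -/
  total : KScheme K
  /-- The bundle projection. -/
  proj : total ⟶ X
  /-- The scalar multiplication. -/
  [scalar : ModObj (affineLine K) total]
  scalar_proj : act (affineLine K) total ≫ proj = snd (affineLine K) total ≫ proj
  locally_trivial (x : X.left) : ∃ V : X.left.Opens, x ∈ V ∧
    ∃ φ : affineLine K ⊗ openSub X V ⟶ total,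
      IsPullback φ (snd (affineLine K) (openSub X V)) proj (openIncl X V) ∧
      affineLine K ◁ φ ≫ act (affineLine K) total =
        (α_ (affineLine K) (affineLine K) (openSub X V)).inv ≫
          μ[affineLine K] ▷ openSub X V ≫ φ

attribute [instance] LineBundle.scalar

/-- The zero section of a line bundle, as a subset of the total space: the image of `e ↦ 0 • e`. -/
def LineBundle.zeroLocus {X : KScheme K} (L : LineBundle X) : Set L.total.left :=
  Set.range (lift (toUnit L.total ≫ origin K) (𝟙 L.total) ≫ act (affineLine K) L.total).left

/-- A `G`-linearized line bundle on the `G`-scheme `X`: a line bundle with an action of `G` on the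
total space such that the projection is equivariant and the induced maps on the fibres are linear,
that is, compatible with scalar multiplication. -/
structure LinearizedLineBundle (G : KScheme K) [MonObj G] (X : KScheme K) [ModObj G X]
    extends LineBundle X where
  /-- The action on the total space. -/
  [action : ModObj G total]
  proj_equivariant : act G total ≫ proj = G ◁ proj ≫ act G X
  /-- `c • (g • e) = g • (c • e)`. -/
  linear : affineLine K ◁ act G total ≫ act (affineLine K) total =
    lift (snd (affineLine K) (G ⊗ total) ≫ fst G total)
      (lift (fst (affineLine K) (G ⊗ total)) (snd (affineLine K) (G ⊗ total) ≫ snd G total)) ≫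
      G ◁ act (affineLine K) total ≫ act G total

attribute [instance] LinearizedLineBundle.action

namespace LinearizedLineBundle

variable {G : KScheme K} [MonObj G] {X : KScheme K} [ModObj G X]

/-- For `n > 0`: `ν` exhibits the linearized line bundle `M` as the `n`-th tensor power of `L`,
where `ν` is the map `e ↦ e ⊗ ⋯ ⊗ e`. It is a morphism over `X` that is equivariant, homogeneous of
degree `n` and nonzero outside the zero section. In local trivializations such a map is
`(c, x) ↦ (u(x) cⁿ, x)` with an invertible function `u`, so `e ⊗ ⋯ ⊗ e ↦ ν(e)` defines an
isomorphism of linearized line bundles from the `n`-th tensor power of `L` to `M`. -/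
structure IsPower (n : ℕ) (L M : LinearizedLineBundle G X) (ν : L.total ⟶ M.total) : Prop where
  comp_proj : ν ≫ M.proj = L.proj
  equivariant : act G L.total ≫ ν = G ◁ ν ≫ act G M.total
  homogeneous : act (affineLine K) L.total ≫ ν =
    ((𝟙 (affineLine K) : affineLine K ⟶ affineLine K) ^ n ⊗ₘ ν) ≫ act (affineLine K) M.total
  nonvanishing (e : L.total.left) : ν.left e ∈ M.zeroLocus → e ∈ L.zeroLocus

/-- A `G`-invariant section of a linearized line bundle. -/
structure IsInvariantSection (M : LinearizedLineBundle G X) (s : X ⟶ M.total) : Prop where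
  section_proj : s ≫ M.proj = 𝟙 X
  equivariant : act G X ≫ s = G ◁ s ≫ act G M.total

/-- The set `X_s` of all points where the section `s` does not vanish. -/
def nonvanishingLocus (M : LinearizedLineBundle G X) (s : X ⟶ M.total) : Set X.left :=
  {x | s.left x ∉ M.zeroLocus}

/-- The set of semistable points of a linearized line bundle in the sense of Mumford: the point `x`
is semistable if some positive power of the bundle has an invariant section `s` such that `X_s` is
an affine neighbourhood of `x`. -/
def semistableLocus (L : LinearizedLineBundle G X) : Set X.left :=
  {x | ∃ (n : ℕ) (M : LinearizedLineBundle G X) (ν : L.total ⟶ M.total) (s : X ⟶ M.total)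
    (V : X.left.Opens), 0 < n ∧ L.IsPower n M ν ∧ M.IsInvariantSection s ∧
      (V : Set X.left) = M.nonvanishingLocus s ∧ IsAffineOpen V ∧ x ∈ V}

end LinearizedLineBundle

end General

/-! ### The quadric cone with its torus action -/

/-- The ideal generated by `z₁z₃ - z₂z₄`; the coordinate `zᵢ` has index `i - 1`. -/
abbrev coneIdeal (K : Type u) [Field K] : Ideal (MvPolynomial (Fin 4) K) :=
  Ideal.span {MvPolynomial.X 0 * MvPolynomial.X 2 - MvPolynomial.X 1 * MvPolynomial.X 3}

/-- The coordinate ring of the quadric cone. -/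
abbrev coneRing (K : Type u) [Field K] : Type u := MvPolynomial (Fin 4) K ⧸ coneIdeal K

/-- The coordinate functions on the cone. -/
def coord (K : Type u) [Field K] (i : Fin 4) : coneRing K :=
  Ideal.Quotient.mk (coneIdeal K) (MvPolynomial.X i)

/-- The quadric cone `X = V(z₁z₃ - z₂z₄)` in `K⁴`. -/
abbrev cone (K : Type u) [Field K] : KScheme K := affineScheme K (coneRing K)

/-- The open subset `X_{z₂z₃} ∪ X_{z₁z₄}` of the cone. -/
def coneOpen (K : Type u) [Field K] : (cone K).left.Opens :=
  (PrimeSpectrum.basicOpen (coord K 1 * coord K 2) ⊔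
    PrimeSpectrum.basicOpen (coord K 0 * coord K 3) :
      TopologicalSpace.Opens (PrimeSpectrum (coneRing K)))

/-- The exponents of the characters by which the torus acts on the coordinates. -/
def weight : Fin 4 → ℤ × ℤ := ![(2, 0), (1, 2), (1, 1), (2, -1)]

/-- The comorphism `zᵢ ↦ χᵢ ⊗ zᵢ` of the action
`t • x = (t₁² x₁, t₁ t₂² x₂, t₁ t₂ x₃, t₁² t₂⁻¹ x₄)`. -/
def coaction (K : Type u) [Field K] :
    coneRing K →ₐ[K] AddMonoidAlgebra K (ℤ × ℤ) ⊗[K] coneRing K :=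
  Ideal.Quotient.liftₐ (coneIdeal K)
    (MvPolynomial.aeval fun i => AddMonoidAlgebra.single (weight i) (1 : K) ⊗ₜ[K] coord K i) (by
      intro a ha
      have h : coneIdeal K ≤ RingHom.ker (MvPolynomial.aeval (R := K) fun i : Fin 4 =>
          AddMonoidAlgebra.single (weight i) (1 : K) ⊗ₜ[K] coord K i) := by
        rw [Ideal.span_le, Set.singleton_subset_iff, SetLike.mem_coe, RingHom.mem_ker]
        have e : coord K 0 * coord K 2 = coord K 1 * coord K 3 := by
          rw [coord, coord, coord, coord, ← map_mul, ← map_mul, Ideal.Quotient.eq]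
          exact Ideal.subset_span rfl
        simp [AddMonoidAlgebra.single_mul_single, weight, e]
      exact h ha)

/-- The action morphism of the torus on the cone. -/
def torusAct (K : Type u) [Field K] : torus K ⊗ cone K ⟶ cone K :=
  prodToSpec K _ _ ≫ affineMap K (coaction K)

section

variable (K : Type u) [Field K]

lemma prodToSpec_fst (A B : Type u) [CommRing A] [CommRing B] [Algebra K A] [Algebra K B] :
    prodToSpec K A B ≫ affineMap K Algebra.TensorProduct.includeLeft = fst _ _ := by
  ext1
  exact pullbackSpecIso_hom_fst K A B

lemma prodToSpec_snd (A B : Type u) [CommRing A] [CommRing B] [Algebra K A] [Algebra K B] :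
    prodToSpec K A B ≫ affineMap K Algebra.TensorProduct.includeRight = snd _ _ := by
  ext1
  exact pullbackSpecIso_hom_snd K A B

/-- Pullback of functions along a morphism to an affine scheme. -/
def comor {A : Type u} [CommRing A] [Algebra K A] {W : KScheme K} (f : W ⟶ affineScheme K A) :
    A →+* Γ(W.left, ⊤) := ((Scheme.ΓSpecIso (.of A)).inv ≫ f.left.appTop).hom

lemma comor_comp_map {A B : Type u} [CommRing A] [CommRing B] [Algebra K A] [Algebra K B]
    {W : KScheme K} (f : W ⟶ affineScheme K A)
    (φ : B →ₐ[K] A) (b : B) : comor K (f ≫ affineMap K φ) b = comor K f (φ b) := by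
  have h (h : W.left ⟶ Spec (.of A)) : (Scheme.ΓSpecIso (.of B)).inv ≫
      (h ≫ Spec.map (CommRingCat.ofHom φ.toRingHom)).appTop
     = CommRingCat.ofHom φ.toRingHom ≫ (Scheme.ΓSpecIso (.of A)).inv ≫ h.appTop := by
    rw [Scheme.Hom.comp_appTop,
      reassoc_of% Scheme.ΓSpecIso_inv_naturality (CommRingCat.ofHom φ.toRingHom)]
  exact congr($(h f.left).hom b)

lemma comor_inj {A : Type u} [CommRing A] [Algebra K A] {W : KScheme K}
    {f g : W ⟶ affineScheme K A} (h : comor K f = comor K g) : f = g := by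
  have h' (a b : W.left ⟶ Spec (.of A)) (hab : (Scheme.ΓSpecIso (.of A)).inv ≫ a.appTop =
      (Scheme.ΓSpecIso (.of A)).inv ≫ b.appTop) : a = b :=
    ext_of_isAffine ((cancel_epi _).mp hab)
  ext1
  exact h' f.left g.left (CommRingCat.hom_ext h)

lemma comor_algebraMap {A : Type u} [CommRing A] [Algebra K A]
    {W : KScheme K} (f g : W ⟶ affineScheme K A) (r : K) :
    comor K f (algebraMap K A r) = comor K g (algebraMap K A r) := by
  have h (f : W ⟶ affineScheme K A) : comor K f (algebraMap K A r) =
      comor K (f ≫ affineMap K (Algebra.ofId K A)) r := (comor_comp_map K f (Algebra.ofId K A) r).symm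
  rw [h f, h g]
  congr 2
  ext1
  exact (Over.w f).trans (Over.w g).symm

lemma comor_lift {A B : Type u} [CommRing A] [CommRing B] [Algebra K A] [Algebra K B]
    {W : KScheme K} (f : W ⟶ affineScheme K A) (g : W ⟶ affineScheme K B) (a : A) (b : B) :
    comor K (lift f g ≫ prodToSpec K A B) (a ⊗ₜ b) = comor K f a * comor K g b := by
  have h1 : comor K f a = comor K (lift f g ≫ prodToSpec K A B)
      (Algebra.TensorProduct.includeLeft (S := K) a) := by
    rw [← comor_comp_map, Category.assoc, prodToSpec_fst, lift_fst]
  have h2 : comor K g b = comor K (lift f g ≫ prodToSpec K A B)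
      (Algebra.TensorProduct.includeRight b) := by
    rw [← comor_comp_map, Category.assoc, prodToSpec_snd, lift_snd]
  rw [h1, h2, ← map_mul]
  simp

lemma comor_act {W : KScheme K} (f : W ⟶ torus K) (g : W ⟶ cone K)
    (i : Fin 4) : comor K (lift f g ≫ torusAct K) (coord K i) =
      comor K f (AddMonoidAlgebra.single (weight i) (1 : K)) * comor K g (coord K i) := by
  rw [← comor_lift, torusAct, ← Category.assoc, comor_comp_map]
  congr 1
  exact (Ideal.Quotient.lift_mk _ _ _).trans (MvPolynomial.aeval_X _ _)

lemma comor_mul {W : KScheme K} (f g : W ⟶ torus K) (w : ℤ × ℤ) :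
    comor K (lift f g ≫ μ[torus K]) (AddMonoidAlgebra.single w (1 : K)) =
      comor K f (AddMonoidAlgebra.single w (1 : K)) *
        comor K g (AddMonoidAlgebra.single w (1 : K)) := by
  have h : μ[torus K] = prodToSpec K _ _ ≫ affineMap K (Bialgebra.comulAlgHom K _) := rfl
  rw [← comor_lift, h, ← Category.assoc, comor_comp_map]
  congr 1
  simp

lemma comor_one {W : KScheme K} (w : ℤ × ℤ) :
    comor K (toUnit W ≫ η[torus K]) (AddMonoidAlgebra.single w (1 : K)) = 1 := by
  have h : toUnit W ≫ η[torus K] =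
      (Over.homMk W.hom (by
        change W.hom ≫ Spec.map (𝟙 _) = W.hom
        simp) : W ⟶ affineScheme K K) ≫ affineMap K (Bialgebra.counitAlgHom K _) := by
    ext1
    rfl
  rw [h, comor_comp_map]
  simp

lemma hom_ext_cone {W : KScheme K} {f g : W ⟶ cone K}
    (h : ∀ i, comor K f (coord K i) = comor K g (coord K i)) : f = g := by
  apply comor_inj
  apply Ideal.Quotient.ringHom_ext
  apply MvPolynomial.ringHom_ext
  · intro r
    exact comor_algebraMap K f g r
  · exact h

end

/-- The torus action on the cone. -/
instance torusAction (K : Type u) [Field K] : ModObj (torus K) (cone K) where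
  smul := torusAct K
  one_smul := by
    apply hom_ext_cone
    intro i
    have h : η[torus K] ▷ cone K =
        lift (toUnit _ ≫ η[torus K]) (snd _ _) := by
      ext1
      · rw [whiskerRight_fst, lift_fst]
        congr 1
      · rw [whiskerRight_snd, lift_snd]
    change comor K (η[torus K] ▷ cone K ≫ torusAct K) _ =
      comor K (λ_ _).hom _
    rw [h, comor_act, comor_one, _root_.one_mul, leftUnitor_hom]
  mul_smul := by
    apply hom_ext_cone
    intro i
    have h : μ[torus K] ▷ cone K =
        lift (lift (fst _ _ ≫ fst _ _) (fst _ _ ≫ snd _ _) ≫ μ[torus K]) (snd _ _) := by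
      ext1 <;> simp
    have h' : (α_ _ _ _).hom ≫ torus K ◁ torusAct K =
        lift (fst _ _ ≫ fst _ _) (lift (fst _ _ ≫ snd _ _) (snd _ _) ≫ torusAct K) := by
      ext1
      · simp
      · simp only [Category.assoc, whiskerLeft_snd, lift_snd]
        rw [← Category.assoc]
        congr 1
        ext1 <;> simp
    change comor K (μ[torus K] ▷ cone K ≫ torusAct K) _ =
      comor K ((α_ _ _ _).hom ≫ torus K ◁ torusAct K ≫ torusAct K) _
    rw [reassoc_of% h', h, comor_act, comor_act, comor_act, comor_mul, _root_.mul_assoc]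

end ConeGIT

end

open ConeGIT

/-!
(i) On each of the patches `x₂x₃ ≠ 0` and `x₁x₄ ≠ 0` the functions are spanned by Laurent monomials
in three of the coordinates, which are weight vectors. The invariant functions are therefore spanned
by the monomials of weight `0`, and form the polynomial rings `K[z₁z₂²/z₃⁴]` and `K[z₂²z₄⁴/z₁⁵]`.
On the overlap the two generators are inverse to each other, so that the quotient maps to the affine
line glue to a map to `ℙ¹`.

(ii) The one-parameter subgroup `s ↦ (s⁻¹, s²)` acts with weights `(-2, 3, 1, -4)`. The points
`(0, 1, 1, 0)` and `(1, 0, 0, 1)` of `U` flow to the fixed point `0`, which is not in `U`, as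
`s → 0` and `s → ∞` respectively. An invariant section of a power of `L` that vanishes at `0` but
not at the first point forces the weight of the subgroup on the fibre of `L` over `0` to have one
sign, and such a section for the second point forces the opposite sign.
-/

noncomputable section

namespace ConeGIT

section Affine

variable (K : Type u) [Field K]

lemma comor_comp {A : Type u} [CommRing A] [Algebra K A] {W W' : KScheme K} (h : W' ⟶ W)
    (f : W ⟶ affineScheme K A) (a : A) :
    comor K (h ≫ f) a = h.left.appTop (comor K f a) := by
  have key {X Y : Scheme.{u}} (h : X ⟶ Y) (f : Y ⟶ Spec (.of A)) :
      (Scheme.ΓSpecIso (.of A)).inv ≫ (h ≫ f).appTop =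
        ((Scheme.ΓSpecIso (.of A)).inv ≫ f.appTop) ≫ h.appTop := by
    rw [Scheme.Hom.comp_appTop, Category.assoc]
  exact congr(($(key h.left f.left)).hom a)

/-- The identification of a `K`-algebra `A` with the ring of global functions on `Spec A`. -/
def toΓ (A : Type u) [CommRing A] [Algebra K A] : A →+* Γ((affineScheme K A).left, ⊤) :=
  comor K (𝟙 (affineScheme K A))

lemma toΓ_bijective (A : Type u) [CommRing A] [Algebra K A] : Function.Bijective (toΓ K A) := by
  have key (f : Spec (.of A) ⟶ Spec (.of A)) [IsIso f] : Function.Bijective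
      ((Scheme.ΓSpecIso (.of A)).inv ≫ f.appTop).hom := by
    have : IsIso f.appTop := inferInstanceAs (IsIso (f.app ⊤))
    exact ConcreteCategory.bijective_of_isIso ((Scheme.ΓSpecIso (.of A)).inv ≫ f.appTop)
  exact key (𝟙 _)

lemma comor_eq_appTop {A : Type u} [CommRing A] [Algebra K A] {W : KScheme K}
    (f : W ⟶ affineScheme K A) (a : A) : comor K f a = f.left.appTop (toΓ K A a) := by
  rw [toΓ, ← comor_comp, Category.comp_id]

lemma exists_affineMap_eq {A B : Type u} [CommRing A] [CommRing B] [Algebra K A] [Algebra K B]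
    (f : affineScheme K B ⟶ affineScheme K A) : ∃ φ : A →ₐ[K] B, f = affineMap K φ := by
  have key (g : Spec (.of B) ⟶ Spec (.of A)) (hg : g ≫ Spec.map (CommRingCat.ofHom
      (algebraMap K A)) = Spec.map (CommRingCat.ofHom (algebraMap K B))) :
      CommRingCat.ofHom (algebraMap K A) ≫ Spec.preimage g =
        CommRingCat.ofHom (algebraMap K B) := by
    apply Spec.map_injective
    rw [Spec.map_comp, Spec.map_preimage, hg]
  have hf := key f.left (Over.w f)
  refine ⟨{ (Spec.preimage f.left).hom with commutes' := fun r => congr($(hf).hom r) }, ?_⟩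
  ext1
  exact (Spec.map_preimage f.left).symm

lemma affineMap_comp {A B C : Type u} [CommRing A] [CommRing B] [CommRing C] [Algebra K A]
    [Algebra K B] [Algebra K C] (φ : A →ₐ[K] B) (ψ : B →ₐ[K] C) :
    affineMap K ψ ≫ affineMap K φ = affineMap K (ψ.comp φ) := by
  ext1
  exact (Spec.map_comp _ _).symm

lemma affineMap_id (A : Type u) [CommRing A] [Algebra K A] :
    affineMap K (AlgHom.id K A) = 𝟙 _ := by
  ext1
  exact Spec.map_id _

/-- The isomorphism of spectra that corresponds to an isomorphism of algebras. -/
def affineIso {A B : Type u} [CommRing A] [CommRing B] [Algebra K A] [Algebra K B]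
    (e : A ≃ₐ[K] B) : affineScheme K B ≅ affineScheme K A where
  hom := affineMap K e.toAlgHom
  inv := affineMap K e.symm.toAlgHom
  hom_inv_id := by rw [affineMap_comp, ← affineMap_id]; exact congrArg _ e.comp_symm
  inv_hom_id := by rw [affineMap_comp, ← affineMap_id]; exact congrArg _ e.symm_comp

instance affineIso_inv_left_isIso {A B : Type u} [CommRing A] [CommRing B] [Algebra K A]
    [Algebra K B] (e : A ≃ₐ[K] B) : IsIso (affineIso K e).inv.left :=
  inferInstanceAs (IsIso ((Over.forget _).mapIso (affineIso K e)).inv)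

lemma affineMap_inj {A B : Type u} [CommRing A] [CommRing B] [Algebra K A] [Algebra K B]
    {φ ψ : A →ₐ[K] B} : affineMap K φ = affineMap K ψ ↔ φ = ψ := by
  refine ⟨fun h => ?_, congrArg _⟩
  have h' : Spec.map (CommRingCat.ofHom φ.toRingHom) = Spec.map (CommRingCat.ofHom ψ.toRingHom) :=
    congr(($h).left)
  ext a
  exact congr(($(Spec.map_injective h')).hom a)

lemma comor_affineMap {A B : Type u} [CommRing A] [CommRing B] [Algebra K A] [Algebra K B]
    (φ : A →ₐ[K] B) (a : A) :
    comor K (affineMap K φ) a = toΓ K B (φ a) := by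
  have h := comor_comp_map K (𝟙 (affineScheme K B)) φ a
  rwa [Category.id_comp] at h

lemma affineScheme_self_hom : (affineScheme K K).hom = 𝟙 (Spec (CommRingCat.of K)) :=
  (congrArg Spec.map (CommRingCat.hom_ext rfl : CommRingCat.ofHom (algebraMap K K) = 𝟙 _)).trans
    (Spec.map_id _)

/-- The structure morphism of a `K`-scheme, with target `Spec K`. -/
def toSpec (W : KScheme K) : W ⟶ affineScheme K K :=
  Over.homMk W.hom (by rw [affineScheme_self_hom]; exact Category.comp_id _)

lemma hom_toSpec_unique {W : KScheme K} (f g : W ⟶ affineScheme K K) : f = g := by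
  apply comor_inj
  ext r
  exact comor_algebraMap K f g r

lemma toSpec_eq_affineMap (A : Type u) [CommRing A] [Algebra K A] :
    toSpec K (affineScheme K A) = affineMap K (Algebra.ofId K A) := hom_toSpec_unique K _ _

end Affine

section AffineLine

variable (K : Type u) [Field K]

/-- The function on `W` that corresponds to a morphism from `W` to the affine line. -/
def value {W : KScheme K} (a : W ⟶ affineLine K) : Γ(W.left, ⊤) :=
  comor K a (AddMonoidAlgebra.single 1 1)

variable {K}

lemma value_injective {W : KScheme K} {a b : W ⟶ affineLine K} (h : value K a = value K b) :
    a = b := by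
  apply comor_inj
  refine AddMonoidAlgebra.ringHom_ext (fun r => ?_) (fun n => ?_)
  · exact comor_algebraMap K a b r
  · have (c : W ⟶ affineLine K) : comor K c (AddMonoidAlgebra.single n 1) = value K c ^ n := by
      rw [value, ← map_pow, AddMonoidAlgebra.single_pow]
      simp
    rw [this, this, h]

lemma value_comp {W W' : KScheme K} (h : W' ⟶ W) (a : W ⟶ affineLine K) :
    value K (h ≫ a) = h.left.appTop (value K a) := comor_comp K h a _

lemma value_mul {W : KScheme K} (a b : W ⟶ affineLine K) :
    value K (a * b) = value K a * value K b := by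
  have h : μ[affineLine K] = prodToSpec K _ _ ≫ affineMap K (Bialgebra.comulAlgHom K _) := rfl
  rw [value, value, value, ← comor_lift, Hom.mul_def, h, ← Category.assoc, comor_comp_map]
  congr 1
  simp

variable (K) in
/-- The morphism from `Spec R` to the affine line that corresponds to a function `r : R`. -/
def toLine {R : Type u} [CommRing R] [Algebra K R] (r : R) : affineScheme K R ⟶ affineLine K :=
  affineMap K (AddMonoidAlgebra.lift K R ℕ (powersHom R r))

lemma value_toLine {R : Type u} [CommRing R] [Algebra K R] (r : R) :
    value K (toLine K r) = toΓ K R r := by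
  rw [value, toLine, comor_affineMap]
  simp

lemma toLine_injective {R : Type u} [CommRing R] [Algebra K R] {r s : R}
    (h : toLine K r = toLine K s) : r = s := by
  have h' := congr(value K $h)
  rw [value_toLine, value_toLine] at h'
  exact (toΓ_bijective K R).1 h'

lemma exists_toLine_eq {R : Type u} [CommRing R] [Algebra K R]
    (a : affineScheme K R ⟶ affineLine K) : ∃ r : R, a = toLine K r := by
  obtain ⟨r, hr⟩ := (toΓ_bijective K R).2 (value K a)
  exact ⟨r, value_injective (by rw [value_toLine, hr])⟩

lemma toLine_mul {R : Type u} [CommRing R] [Algebra K R] (r s : R) :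
    toLine K (r * s) = toLine K r * toLine K s :=
  value_injective (by rw [value_mul, value_toLine, value_toLine, value_toLine, map_mul])

lemma toLine_one {R : Type u} [CommRing R] [Algebra K R] : toLine K (1 : R) = 1 := by
  obtain ⟨r, hr⟩ := exists_toLine_eq (1 : affineScheme K R ⟶ affineLine K)
  calc toLine K (1 : R) = toLine K 1 * toLine K r := by rw [← hr, _root_.mul_one]
    _ = 1 := by rw [← toLine_mul, _root_.one_mul, hr]

lemma toLine_pow {R : Type u} [CommRing R] [Algebra K R] (r : R) (n : ℕ) :
    toLine K (r ^ n) = toLine K r ^ n := by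
  induction n with
  | zero => rw [pow_zero, pow_zero, toLine_one]
  | succ n ih => rw [pow_succ, pow_succ, toLine_mul, ih]

lemma affineMap_comp_toLine {R S : Type u} [CommRing R] [Algebra K R] [CommRing S] [Algebra K S]
    (φ : R →ₐ[K] S) (r : R) : affineMap K φ ≫ toLine K r = toLine K (φ r) := by
  rw [toLine, toLine, affineMap_comp]
  congr 1
  ext
  simp

lemma value_origin (W : KScheme K) : value K (toUnit W ≫ origin K) = 0 := by
  have h : toUnit W ≫ origin K = (toUnit W ≫ toSpec K _) ≫ toLine K (0 : K) := by
    rw [Category.assoc]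
    congr 1
  rw [h, value_comp, value_toLine, map_zero, map_zero]

lemma toLine_zero {R : Type u} [CommRing R] [Algebra K R] :
    toLine K (0 : R) = toUnit _ ≫ origin K :=
  value_injective (by rw [value_origin, value_toLine, map_zero])

end AffineLine

section OpenImmersions

variable {K : Type u} [Field K]

instance openIncl_left_isOpenImmersion (X : KScheme K) (V : X.left.Opens) :
    IsOpenImmersion (openIncl X V).left :=
  inferInstanceAs (IsOpenImmersion V.ι)

instance mono_of_isOpenImmersion {X Y : KScheme K} (f : X ⟶ Y) [IsOpenImmersion f.left] : Mono f :=
  (Over.forget _).mono_of_mono_map (inferInstanceAs (Mono f.left))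

/-- The lift of a morphism along an open immersion of `K`-schemes. -/
def immersionLift {W X Y : KScheme K} (j : Y ⟶ X) [IsOpenImmersion j.left] (f : W ⟶ X)
    (hf : Set.range f.left ⊆ Set.range j.left) : W ⟶ Y :=
  Over.homMk (IsOpenImmersion.lift j.left f.left hf) (by
    rw [← Over.w j, ← Category.assoc, IsOpenImmersion.lift_fac, Over.w f])

lemma immersionLift_comp {W X Y : KScheme K} (j : Y ⟶ X) [IsOpenImmersion j.left] (f : W ⟶ X)
    (hf : Set.range f.left ⊆ Set.range j.left) : immersionLift j f hf ≫ j = f := by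
  ext1
  exact IsOpenImmersion.lift_fac _ _ _

lemma range_openIncl (X : KScheme K) (V : X.left.Opens) :
    Set.range (openIncl X V).left = (V : Set X.left) :=
  V.range_ι

lemma exists_comp_openIncl_of_local {X : KScheme K} {V : X.left.Opens} {R : Type u} [CommRing R]
    [IsLocalRing R] [Algebra K R] (c : affineScheme K R ⟶ X)
    (hc : c.left (IsLocalRing.closedPoint R) ∈ V) :
    ∃ c' : affineScheme K R ⟶ openSub X V, c' ≫ openIncl X V = c := by
  suffices hr : Set.range c.left ⊆ Set.range (openIncl X V).left from
    ⟨immersionLift _ c hr, immersionLift_comp _ _ _⟩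
  rw [range_openIncl]
  rintro _ ⟨x, rfl⟩
  have hx : x ⤳ (IsLocalRing.closedPoint R : (affineScheme K R).left) :=
    IsLocalRing.specializes_closedPoint (R := R) x
  exact (hx.map c.left.continuous).mem_open V.2 hc

lemma exists_comp_eq_comp {X Y Z : KScheme K} (f : X ⟶ Z) (g : Y ⟶ Z) {x : X.left} {y : Y.left}
    (h : f.left x = g.left y) :
    ∃ (P : KScheme K) (p : P ⟶ X) (q : P ⟶ Y), Nonempty P.left ∧ p ≫ f = q ≫ g := by
  obtain ⟨z, -⟩ := Scheme.Pullback.exists_preimage_pullback x y h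
  let P : KScheme K := Over.mk (Limits.pullback.fst f.left g.left ≫ X.hom)
  let p : P ⟶ X := Over.homMk (Limits.pullback.fst _ _) rfl
  let q : P ⟶ Y := Over.homMk (Limits.pullback.snd _ _) (by
    change _ = Limits.pullback.fst _ _ ≫ X.hom
    rw [← Over.w f, Limits.pullback.condition_assoc, Over.w g])
  refine ⟨P, p, q, ⟨z⟩, ?_⟩
  ext1
  exact Limits.pullback.condition

end OpenImmersions

section Frames

variable {K : Type u} [Field K] {X : KScheme K}

/-- A frame of a line bundle `L` along `W ⟶ X`: a morphism `e : W ⟶ L` such that over every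
`W' ⟶ W` each section of `L` is a unique multiple of `e`, that is, a nowhere vanishing section. -/
def LineBundle.IsFrame (L : LineBundle X) {W : KScheme K} (e : W ⟶ L.total) : Prop :=
  ∀ ⦃W' : KScheme K⦄ (h : W' ⟶ W) (e' : W' ⟶ L.total), e' ≫ L.proj = h ≫ e ≫ L.proj →
    ∃! a : W' ⟶ affineLine K, a • (h ≫ e) = e'

variable {L : LineBundle X}

lemma LineBundle.smul_proj (L : LineBundle X) {W : KScheme K} (a : W ⟶ affineLine K)
    (e : W ⟶ L.total) : (a • e) ≫ L.proj = e ≫ L.proj := by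
  have := L.scalar_proj
  rw [act] at this
  rw [Hom.smul_def, Category.assoc, this, ← Category.assoc, lift_snd]

lemma LineBundle.IsFrame.comp {W W' : KScheme K} {e : W ⟶ L.total} (he : L.IsFrame e)
    (h : W' ⟶ W) : L.IsFrame (h ≫ e) := by
  intro W'' h' e' he'
  simpa using he (h' ≫ h) e' (by simpa using he')

lemma LineBundle.IsFrame.exists_smul_eq {W : KScheme K} {e e' : W ⟶ L.total} (he : L.IsFrame e)
    (h : e' ≫ L.proj = e ≫ L.proj) : ∃ a : W ⟶ affineLine K, a • e = e' := by
  obtain ⟨a, ha, -⟩ := he (𝟙 W) e' (by simpa using h)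
  exact ⟨a, by simpa using ha⟩

lemma LineBundle.IsFrame.smul_injective {W : KScheme K} {e : W ⟶ L.total} (he : L.IsFrame e)
    {a b : W ⟶ affineLine K} (h : a • e = b • e) : a = b := by
  apply (he (𝟙 W) (b • e) (by simp [L.smul_proj])).unique <;> simp [h]

lemma smul_lift_comp {V Y : KScheme K} [ModObj (affineLine K) Y] {φ : affineLine K ⊗ V ⟶ Y}
    (hφ : affineLine K ◁ φ ≫ act (affineLine K) Y =
      (α_ (affineLine K) (affineLine K) V).inv ≫ μ[affineLine K] ▷ V ≫ φ)
    {W : KScheme K} (a b : W ⟶ affineLine K) (f : W ⟶ V) :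
    a • (lift b f ≫ φ) = lift (a * b) f ≫ φ := by
  have h₁ : lift a (lift b f ≫ φ) = lift a (lift b f) ≫ affineLine K ◁ φ := by
    ext1 <;> simp
  have h₂ : lift a (lift b f) ≫ (α_ _ _ _).inv ≫ μ[affineLine K] ▷ V = lift (a * b) f := by
    rw [lift_lift_associator_inv_assoc, lift_whiskerRight, Hom.mul_def]
  rw [act] at hφ
  rw [Hom.smul_def, h₁, Category.assoc, hφ, ← reassoc_of% h₂]

lemma LineBundle.isFrame_of_isPullback {V : KScheme K} {j : V ⟶ X}
    {φ : affineLine K ⊗ V ⟶ L.total} (hφ : IsPullback φ (snd (affineLine K) V) L.proj j)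
    (hlin : affineLine K ◁ φ ≫ act (affineLine K) L.total =
      (α_ (affineLine K) (affineLine K) V).inv ≫ μ[affineLine K] ▷ V ≫ φ) :
    L.IsFrame (lift 1 (𝟙 V) ≫ φ) := by
  intro W h e' he'
  have smul_frame (a : W ⟶ affineLine K) : a • (h ≫ lift 1 (𝟙 V) ≫ φ) = lift a h ≫ φ := by
    rw [← Category.assoc, comp_lift, MonObj.comp_one, smul_lift_comp hlin, _root_.mul_one,
      Category.comp_id]
  have hw : e' ≫ L.proj = h ≫ j := by
    rw [he', Category.assoc, hφ.w, lift_snd_assoc, Category.id_comp]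
  refine ⟨hφ.lift e' h hw ≫ fst _ _, ?_, fun b hb => ?_⟩
  · have : lift (hφ.lift e' h hw ≫ fst _ _) h = hφ.lift e' h hw := by
      ext1
      · rw [lift_fst]
      · rw [lift_snd, hφ.lift_snd]
    exact (smul_frame _).trans (by rw [this, hφ.lift_fst])
  · have : lift b h = hφ.lift e' h hw := by
      apply hφ.hom_ext
      · rw [← smul_frame, hb, hφ.lift_fst]
      · rw [lift_snd, hφ.lift_snd]
    rw [← this, lift_fst]

lemma LineBundle.exists_isFrame_of_local (L : LineBundle X) {R : Type u} [CommRing R]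
    [IsLocalRing R] [Algebra K R] (c : affineScheme K R ⟶ X) :
    ∃ e : affineScheme K R ⟶ L.total, e ≫ L.proj = c ∧ L.IsFrame e := by
  obtain ⟨V, hV, φ, hφ, hlin⟩ := L.locally_trivial (c.left (IsLocalRing.closedPoint R))
  obtain ⟨c', rfl⟩ := exists_comp_openIncl_of_local c hV
  refine ⟨c' ≫ lift 1 (𝟙 _) ≫ φ, ?_, (isFrame_of_isPullback hφ hlin).comp c'⟩
  rw [Category.assoc, Category.assoc, hφ.w, lift_snd_assoc, Category.id_comp]

/-- The endomorphism `e ↦ 0 • e` of the total space. -/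
def LineBundle.zeroMap (L : LineBundle X) : L.total ⟶ L.total :=
  lift (toUnit L.total ≫ origin K) (𝟙 L.total) ≫ act (affineLine K) L.total

lemma LineBundle.comp_zeroMap (L : LineBundle X) {W : KScheme K} (e : W ⟶ L.total) :
    e ≫ L.zeroMap = (toUnit W ≫ origin K) • e := by
  rw [zeroMap, Hom.smul_def, ← Category.assoc, comp_lift, Category.comp_id, ← Category.assoc,
    comp_toUnit]

lemma LineBundle.zero_smul_mem_zeroLocus (L : LineBundle X) {W : KScheme K} (e : W ⟶ L.total)
    (x : W.left) : ((toUnit W ≫ origin K) • e : W ⟶ L.total).left x ∈ L.zeroLocus := by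
  rw [← L.comp_zeroMap]
  exact ⟨e.left x, rfl⟩

lemma LineBundle.zero_smul_zero_smul (L : LineBundle X) {W : KScheme K} (e : W ⟶ L.total) :
    (toUnit W ≫ origin K) • ((toUnit W ≫ origin K) • e) = (toUnit W ≫ origin K) • e := by
  have h : ((toUnit W ≫ origin K) * (toUnit W ≫ origin K) : W ⟶ affineLine K) =
      toUnit W ≫ origin K := value_injective (by simp [value_mul, value_origin])
  exact (mul_smul _ _ e).symm.trans (by rw [h])

lemma LineBundle.IsFrame.not_isUnit_of_mem_zeroLocus {W : KScheme K} {e : W ⟶ L.total}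
    (he : L.IsFrame e) (a : W ⟶ affineLine K) {x : W.left}
    (hx : (a • e : W ⟶ L.total).left x ∈ L.zeroLocus) : ¬ IsUnit (value K a) := by
  obtain ⟨y, hy⟩ := hx
  obtain ⟨P, p, q, ⟨z⟩, hpq⟩ := exists_comp_eq_comp (a • e) L.zeroMap hy.symm
  rw [ModObj.comp_smul, L.comp_zeroMap] at hpq
  have zero_mul_smul : ((toUnit P ≫ origin K) * (p ≫ a)) • (p ≫ e) = (p ≫ a) • (p ≫ e) := by
    rw [mul_smul, hpq, L.zero_smul_zero_smul]
  have value_eq_zero := congr(value K $((he.comp p).smul_injective zero_mul_smul))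
  rw [value_mul, value_origin, zero_mul, value_comp] at value_eq_zero
  intro hu
  have : Nonempty (⊤ : P.left.Opens) := ⟨⟨z, trivial⟩⟩
  have hu' : IsUnit (p.left.appTop (value K a)) := hu.map p.left.appTop.hom
  exact not_isUnit_zero (value_eq_zero ▸ hu')

section Affine

variable {R : Type u} [CommRing R] [Algebra K R] {e : affineScheme K R ⟶ L.total}

lemma LineBundle.IsFrame.exists_toLine_smul_eq (he : L.IsFrame e)
    {e' : affineScheme K R ⟶ L.total} (h : e' ≫ L.proj = e ≫ L.proj) :
    ∃ r : R, toLine K r • e = e' := by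
  obtain ⟨a, ha⟩ := he.exists_smul_eq h
  obtain ⟨r, rfl⟩ := exists_toLine_eq a
  exact ⟨r, ha⟩

lemma LineBundle.IsFrame.toLine_smul_injective (he : L.IsFrame e) {r s : R}
    (h : toLine K r • e = toLine K s • e) : r = s :=
  toLine_injective (he.smul_injective h)

lemma LineBundle.IsFrame.not_isUnit_of_toLine_smul_mem_zeroLocus (he : L.IsFrame e) {r : R}
    {x : (affineScheme K R).left}
    (hx : (toLine K r • e : affineScheme K R ⟶ L.total).left x ∈ L.zeroLocus) : ¬ IsUnit r := by
  intro hr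
  refine he.not_isUnit_of_mem_zeroLocus _ hx ?_
  rw [value_toLine]
  exact hr.map _

lemma LineBundle.toLine_zero_smul_mem_zeroLocus (L : LineBundle X)
    (e : affineScheme K R ⟶ L.total) (x : (affineScheme K R).left) :
    (toLine K (0 : R) • e : affineScheme K R ⟶ L.total).left x ∈ L.zeroLocus := by
  rw [toLine_zero]
  exact L.zero_smul_mem_zeroLocus e x

lemma LineBundle.IsFrame.notMem_zeroLocus (he : L.IsFrame e) (x : (affineScheme K R).left) :
    e.left x ∉ L.zeroLocus := by
  intro hx
  rw [← one_smul (affineScheme K R ⟶ affineLine K) e, ← toLine_one] at hx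
  exact he.not_isUnit_of_toLine_smul_mem_zeroLocus hx isUnit_one

lemma toLine_mul_smul {E : KScheme K} [ModObj (affineLine K) E] (r s : R)
    (e : affineScheme K R ⟶ E) : toLine K (r * s) • e = toLine K r • toLine K s • e := by
  rw [toLine_mul, mul_smul]

end Affine

end Frames

section LinearizedLineBundle

variable {K : Type u} [Field K] {G : KScheme K} [MonObj G] {X : KScheme K} [ModObj G X]
  {L M : LinearizedLineBundle G X}

namespace LinearizedLineBundle

instance isModHom_proj (M : LinearizedLineBundle G X) : IsModHom G M.proj :=
  ⟨M.proj_equivariant⟩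

lemma IsInvariantSection.isModHom {s : X ⟶ M.total} (hs : M.IsInvariantSection s) :
    IsModHom G s :=
  ⟨hs.equivariant⟩

lemma linear_smul_comm (M : LinearizedLineBundle G X) {W : KScheme K} (g : W ⟶ G)
    (a : W ⟶ affineLine K) (e : W ⟶ M.total) : a • (g • e) = g • (a • e) := by
  have h := congr(lift a (lift g e) ≫ $(M.linear))
  have h₁ : lift a (lift g e) ≫ affineLine K ◁ γ[G, M.total] = lift a (g • e) := by
    ext1 <;> simp [Hom.smul_def]
  have h₂ : lift a (lift g e) ≫ lift (snd (affineLine K) (G ⊗ M.total) ≫ fst G M.total)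
      (lift (fst (affineLine K) (G ⊗ M.total)) (snd (affineLine K) (G ⊗ M.total) ≫ snd G M.total))
      ≫ G ◁ γ[affineLine K, M.total] = lift g (a • e) := by
    ext1 <;> simp [Hom.smul_def, comp_lift_assoc]
  rwa [act, act, reassoc_of% h₁, reassoc_of% h₂] at h

variable {n : ℕ} {ν : L.total ⟶ M.total}

lemma IsPower.isModHom (hν : L.IsPower n M ν) : IsModHom G ν :=
  ⟨hν.equivariant⟩

lemma IsPower.smul_comp (hν : L.IsPower n M ν) {W : KScheme K} (a : W ⟶ affineLine K)
    (e : W ⟶ L.total) : (a • e) ≫ ν = (a ^ n) • (e ≫ ν) := by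
  have h := hν.homogeneous
  rw [act, act] at h
  rw [Hom.smul_def, Hom.smul_def, Category.assoc, h, ← Category.assoc]
  congr 1
  ext1
  · rw [Category.assoc, tensorHom_fst, lift_fst_assoc, MonObj.comp_pow, Category.comp_id, lift_fst]
  · simp

lemma IsPower.pow_eq_of_smul_eq (hν : L.IsPower n M ν) {g : affineScheme K K ⟶ G}
    {e : affineScheme K K ⟶ L.total} (he : L.IsFrame e)
    {e' : affineScheme K K ⟶ M.total} (he' : M.IsFrame e') (h : e' ≫ M.proj = e ≫ L.proj)
    {a b : K} (ha : g • e = toLine K a • e) (hb : g • e' = toLine K b • e') : a ^ n = b := by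
  have hνe : (e ≫ ν) ≫ M.proj = e' ≫ M.proj := by rw [Category.assoc, hν.comp_proj, h]
  obtain ⟨r, hr⟩ := he'.exists_toLine_smul_eq hνe
  have r_ne_zero : r ≠ 0 := by
    rintro rfl
    refine he.notMem_zeroLocus (IsLocalRing.closedPoint K) (hν.nonvanishing _ ?_)
    change (e ≫ ν).left _ ∈ _
    rw [← hr]
    exact M.toLine_zero_smul_mem_zeroLocus _ _
  refine mul_left_cancel₀ r_ne_zero (he'.toLine_smul_injective ?_)
  have := hν.isModHom
  calc toLine K (r * a ^ n) • e'
      = (toLine K a ^ n) • (e ≫ ν) := by rw [← hr, mul_comm, toLine_mul_smul, toLine_pow]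
    _ = g • (e ≫ ν) := by rw [← hν.smul_comp, ← ha, IsModHom.map_smul]
    _ = toLine K (r * b) • e' := by rw [← hr, ← linear_smul_comm, hb, toLine_mul_smul]

end LinearizedLineBundle

end LinearizedLineBundle

section FormalDisc

variable {K : Type u} [Field K]

variable (K) in
/-- The closed point of the formal disc `Spec K⟦t⟧`. -/
def discOrigin : affineScheme K K ⟶ affineScheme K (PowerSeries K) :=
  affineMap K { PowerSeries.constantCoeff (R := K) with
    commutes' := fun r => PowerSeries.constantCoeff_C r }

/-- The endomorphism `t ↦ q t` of the formal disc. -/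
def discRescale (q : K) : affineScheme K (PowerSeries K) ⟶ affineScheme K (PowerSeries K) :=
  affineMap K (PowerSeries.rescaleAlgHom q)

lemma discOrigin_rescale (q : K) : discOrigin K ≫ discRescale q = discOrigin K := by
  rw [discOrigin, discRescale, affineMap_comp]
  congr 1
  refine AlgHom.ext fun f => ?_
  change PowerSeries.constantCoeff ((PowerSeries.rescaleAlgHom q : _ →+* _) f) =
    PowerSeries.constantCoeff f
  rw [PowerSeries.coe_rescaleAlgHom, ← PowerSeries.coeff_zero_eq_constantCoeff_apply,
    PowerSeries.coeff_rescale, pow_zero, _root_.one_mul,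
    PowerSeries.coeff_zero_eq_constantCoeff_apply]

lemma discOrigin_toLine (f : PowerSeries K) :
    discOrigin K ≫ toLine K f = toLine K (PowerSeries.constantCoeff f) :=
  affineMap_comp_toLine _ f

lemma discRescale_toLine (q : K) (f : PowerSeries K) :
    discRescale q ≫ toLine K f = toLine K (PowerSeries.rescale q f) := by
  rw [← PowerSeries.coe_rescaleAlgHom]
  exact affineMap_comp_toLine _ f

lemma constantCoeff_eq_pow_order_of_rescale_eq_mul {q : K} {f u : PowerSeries K} (hf : f ≠ 0)
    (h : PowerSeries.rescale q f = f * u) :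
    PowerSeries.constantCoeff u = q ^ f.order.toNat := by
  have hlead : PowerSeries.coeff f.order.toNat (f * u) =
      PowerSeries.coeff f.order.toNat f * PowerSeries.constantCoeff u := by
    have := PowerSeries.coeff_X_pow_mul (f.divXPowOrder * u) f.order.toNat 0
    rwa [← _root_.mul_assoc, PowerSeries.X_pow_order_mul_divXPowOrder, Nat.zero_add,
      PowerSeries.coeff_zero_eq_constantCoeff_apply, map_mul PowerSeries.constantCoeff,
      PowerSeries.constantCoeff_divXPowOrder] at this
  have hcoeff := congr(PowerSeries.coeff f.order.toNat $h)
  rw [PowerSeries.coeff_rescale, hlead, mul_comm] at hcoeff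
  exact (mul_left_cancel₀ (PowerSeries.coeff_order hf) hcoeff).symm

lemma exists_pow_of_rescale_eq_mul {q : K} {f u : PowerSeries K} (hf : f ≠ 0)
    (h0 : PowerSeries.constantCoeff f = 0) (h : PowerSeries.rescale q f = f * u) :
    ∃ k : ℕ, 0 < k ∧ PowerSeries.constantCoeff u = q ^ k := by
  refine ⟨f.order.toNat, Nat.pos_of_ne_zero fun hk => PowerSeries.coeff_order hf ?_,
    constantCoeff_eq_pow_order_of_rescale_eq_mul hf h⟩
  rw [hk, PowerSeries.coeff_zero_eq_constantCoeff_apply, h0]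

end FormalDisc

section HilbertMumford

open LinearizedLineBundle

variable {K : Type u} [Field K] {G : KScheme K} [MonObj G] {X : KScheme K} [ModObj G X]
  {L M : LinearizedLineBundle G X} {s : X ⟶ M.total} {q : K}
  {c : affineScheme K (PowerSeries K) ⟶ X} {g : affineScheme K K ⟶ G}

lemma smul_discOrigin_comp {e : affineScheme K (PowerSeries K) ⟶ M.total} {u : PowerSeries K}
    (hu : toLine K u • (discRescale q ≫ e) =
      (toSpec K (affineScheme K (PowerSeries K)) ≫ g) • e) :
    g • (discOrigin K ≫ e) =
      toLine K (PowerSeries.constantCoeff u) • (discOrigin K ≫ e) := by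
  have h := congr(discOrigin K ≫ $hu)
  rw [ModObj.comp_smul, ModObj.comp_smul, ← Category.assoc, discOrigin_rescale,
    ← Category.assoc, hom_toSpec_unique K (discOrigin K ≫ toSpec K _) (𝟙 _),
    Category.id_comp, discOrigin_toLine] at h
  exact h.symm

lemma rescale_eq_mul_of_isInvariantSection (hs : M.IsInvariantSection s)
    (hg : (toSpec K (affineScheme K (PowerSeries K)) ≫ g) • c = discRescale q ≫ c)
    {e : affineScheme K (PowerSeries K) ⟶ M.total} (he : M.IsFrame e) {f u : PowerSeries K}
    (hf : toLine K f • e = c ≫ s)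
    (hu : toLine K u • (discRescale q ≫ e) =
      (toSpec K (affineScheme K (PowerSeries K)) ≫ g) • e) :
    PowerSeries.rescale q f = f * u := by
  have := hs.isModHom
  refine (he.comp (discRescale q)).toLine_smul_injective ?_
  calc toLine K (PowerSeries.rescale q f) • (discRescale q ≫ e)
      = discRescale q ≫ (toLine K f • e) := by rw [ModObj.comp_smul, discRescale_toLine]
    _ = (toSpec K (affineScheme K (PowerSeries K)) ≫ g) • (toLine K f • e) := by
        rw [hf, ← IsModHom.map_smul, hg, Category.assoc]
    _ = toLine K (f * u) • (discRescale q ≫ e) := by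
        rw [← linear_smul_comm, ← hu, toLine_mul_smul]

lemma exists_smul_eq_pow_smul_of_isInvariantSection (hs : M.IsInvariantSection s)
    (hg : (toSpec K (affineScheme K (PowerSeries K)) ≫ g) • c = discRescale q ≫ c)
    (h0 : ∃ x, (discOrigin K ≫ c ≫ s).left x ∈ M.zeroLocus)
    (h1 : ∃ x, (c ≫ s).left x ∉ M.zeroLocus) :
    ∃ (e : affineScheme K K ⟶ M.total) (k : ℕ), M.IsFrame e ∧ e ≫ M.proj = discOrigin K ≫ c ∧
      0 < k ∧ g • e = toLine K (q ^ k) • e := by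
  obtain ⟨e, hec, he⟩ := M.exists_isFrame_of_local c
  have hcs : (c ≫ s) ≫ M.proj = e ≫ M.proj := by
    rw [hec, Category.assoc, hs.section_proj, Category.comp_id]
  have hge : ((toSpec K (affineScheme K (PowerSeries K)) ≫ g) • e) ≫ M.proj =
      (discRescale q ≫ e) ≫ M.proj := by
    rw [IsModHom.map_smul, hec, hg, Category.assoc, hec]
  obtain ⟨f, hf⟩ := he.exists_toLine_smul_eq hcs
  obtain ⟨u, hu⟩ := (he.comp (discRescale q)).exists_toLine_smul_eq hge
  have hf0 : PowerSeries.constantCoeff f = 0 := by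
    obtain ⟨x, hx⟩ := h0
    rw [← hf, ModObj.comp_smul, discOrigin_toLine] at hx
    exact not_ne_iff.mp fun hne =>
      (he.comp (discOrigin K)).not_isUnit_of_toLine_smul_mem_zeroLocus hx (IsUnit.mk0 _ hne)
  have hf1 : f ≠ 0 := by
    rintro rfl
    obtain ⟨x, hx⟩ := h1
    rw [← hf] at hx
    exact hx (M.toLine_zero_smul_mem_zeroLocus _ _)
  obtain ⟨k, hk, hku⟩ := exists_pow_of_rescale_eq_mul hf1 hf0
    (rescale_eq_mul_of_isInvariantSection hs hg he hf hu)
  exact ⟨discOrigin K ≫ e, k, he.comp _, by rw [Category.assoc, hec], hk,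
    hku ▸ smul_discOrigin_comp hu⟩

/-- The Hilbert–Mumford weight: a one-parameter limit at which an invariant section of a power of
`L` vanishes determines the character on the fibre over the limit point. -/
lemma exists_pow_eq_of_isInvariantSection {n : ℕ} {ν : L.total ⟶ M.total} (hν : L.IsPower n M ν)
    (hs : M.IsInvariantSection s)
    (hg : (toSpec K (affineScheme K (PowerSeries K)) ≫ g) • c = discRescale q ≫ c)
    (h0 : ∃ x, (discOrigin K ≫ c ≫ s).left x ∈ M.zeroLocus)
    (h1 : ∃ x, (c ≫ s).left x ∉ M.zeroLocus)
    {e : affineScheme K K ⟶ L.total} (he : L.IsFrame e)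
    (hec : e ≫ L.proj = discOrigin K ≫ c) {a : K} (ha : g • e = toLine K a • e) :
    ∃ k : ℕ, 0 < k ∧ a ^ n = q ^ k := by
  obtain ⟨e', k, he', hec', hk, hgk⟩ := exists_smul_eq_pow_smul_of_isInvariantSection hs hg h0 h1
  exact ⟨k, hk, hν.pow_eq_of_smul_eq he he' (hec'.trans hec.symm) ha hgk⟩

end HilbertMumford

section Points

variable {K : Type u} [Field K]

/-- The homomorphism from the coordinate ring of the cone that corresponds to the point of the cone
with coordinates `z` in the `K`-algebra `R`. -/
def coneHom {R : Type u} [CommRing R] [Algebra K R] (z : Fin 4 → R)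
    (h : z 0 * z 2 = z 1 * z 3) : coneRing K →ₐ[K] R :=
  Ideal.Quotient.liftₐ (coneIdeal K) (MvPolynomial.aeval z) (by
    have h' : coneIdeal K ≤ RingHom.ker (MvPolynomial.aeval (R := K) z) := by
      rw [Ideal.span_le, Set.singleton_subset_iff, SetLike.mem_coe, RingHom.mem_ker]
      simp [h]
    exact fun a ha => h' ha)

@[simp]
lemma coneHom_coord {R : Type u} [CommRing R] [Algebra K R] (z : Fin 4 → R)
    (h : z 0 * z 2 = z 1 * z 3) (i : Fin 4) : coneHom z h (coord K i) = z i :=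
  (Ideal.Quotient.lift_mk _ _ _).trans (MvPolynomial.aeval_X _ _)

lemma coneRing_algHom_ext {R : Type u} [CommRing R] [Algebra K R] {φ ψ : coneRing K →ₐ[K] R}
    (h : ∀ i, φ (coord K i) = ψ (coord K i)) : φ = ψ := by
  apply Ideal.Quotient.algHom_ext
  apply MvPolynomial.algHom_ext
  exact h

/-- Evaluation of characters at the point `(t₁, t₂)` of the torus. -/
def torusHom (t₁ t₂ : Kˣ) : AddMonoidAlgebra K (ℤ × ℤ) →ₐ[K] K :=
  AddMonoidAlgebra.lift K K (ℤ × ℤ)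
    { toFun := fun w => ((t₁ ^ w.toAdd.1 * t₂ ^ w.toAdd.2 : Kˣ) : K)
      map_one' := by simp
      map_mul' := fun v w => by
        rw [← Units.val_mul, toAdd_mul, Prod.fst_add, Prod.snd_add, zpow_add, zpow_add,
          _root_.mul_mul_mul_comm] }

lemma torusHom_single (t₁ t₂ : Kˣ) (w : ℤ × ℤ) :
    torusHom t₁ t₂ (AddMonoidAlgebra.single w 1) = ((t₁ ^ w.1 * t₂ ^ w.2 : Kˣ) : K) := by
  simp [torusHom]

lemma comor_smul {W : KScheme K} (g : W ⟶ torus K) (x : W ⟶ cone K) (i : Fin 4) :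
    comor K (g • x) (coord K i) =
      comor K g (AddMonoidAlgebra.single (weight i) (1 : K)) * comor K x (coord K i) :=
  comor_act K g x i

lemma affineMap_smul_affineMap {R : Type u} [CommRing R] [Algebra K R]
    (θ : AddMonoidAlgebra K (ℤ × ℤ) →ₐ[K] R) {φ ψ : coneRing K →ₐ[K] R}
    (h : ∀ i, θ (AddMonoidAlgebra.single (weight i) (1 : K)) * φ (coord K i) = ψ (coord K i)) :
    affineMap K θ • affineMap K φ = affineMap K ψ := by
  apply hom_ext_cone
  intro i
  rw [comor_smul, comor_affineMap, comor_affineMap, comor_affineMap, ← map_mul, h]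

lemma affineMap_left_mem_coneOpen {R : Type u} [CommRing R] [Algebra K R]
    (φ : coneRing K →ₐ[K] R) (x : PrimeSpectrum R) :
    (affineMap K φ).left x ∈ coneOpen K ↔
      φ (coord K 1) * φ (coord K 2) ∉ x.asIdeal ∨ φ (coord K 0) * φ (coord K 3) ∉ x.asIdeal := by
  rw [← map_mul, ← map_mul]
  exact Iff.rfl

variable (K) in
/-- The vertex `0` of the cone. -/
def vertex : affineScheme K K ⟶ cone K := affineMap K (coneHom 0 (by simp))

lemma vertex_notMem_coneOpen (x : (affineScheme K K).left) : (vertex K).left x ∉ coneOpen K := by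
  intro hx
  simpa using (affineMap_left_mem_coneOpen _ x).1 hx

lemma affineMap_smul_vertex (θ : AddMonoidAlgebra K (ℤ × ℤ) →ₐ[K] K) :
    affineMap K θ • vertex K = vertex K :=
  affineMap_smul_affineMap θ (by simp)

lemma discOrigin_comp_affineMap {φ : coneRing K →ₐ[K] PowerSeries K}
    (hφ : ∀ i, PowerSeries.constantCoeff (φ (coord K i)) = 0) :
    discOrigin K ≫ affineMap K φ = vertex K := by
  rw [discOrigin, affineMap_comp, vertex]
  congr 1
  apply coneRing_algHom_ext
  intro i
  rw [coneHom_coord]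
  exact hφ i

end Points

section Unstable

variable {K : Type u} [Field K] {L : LinearizedLineBundle (torus K) (cone K)}

lemma exists_pow_eq_of_curve (hL : L.semistableLocus = (coneOpen K : Set (cone K).left))
    {φ : coneRing K →ₐ[K] PowerSeries K} {q : K} {θ : AddMonoidAlgebra K (ℤ × ℤ) →ₐ[K] K}
    (hθ : ∀ i, algebraMap K _ (θ (AddMonoidAlgebra.single (weight i) (1 : K))) *
      φ (coord K i) = PowerSeries.rescale q (φ (coord K i)))
    (hφ : φ (coord K 1) * φ (coord K 2) ≠ 0 ∨ φ (coord K 0) * φ (coord K 3) ≠ 0)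
    (hφ₀ : ∀ i, PowerSeries.constantCoeff (φ (coord K i)) = 0)
    {e : affineScheme K K ⟶ L.total} (he : L.IsFrame e) (hev : e ≫ L.proj = vertex K) {a : K}
    (ha : affineMap K θ • e = toLine K a • e) :
    ∃ n k : ℕ, 0 < n ∧ 0 < k ∧ a ^ n = q ^ k := by
  have generic_mem : (affineMap K φ).left (⊥ : PrimeSpectrum (PowerSeries K)) ∈
      L.semistableLocus := by
    rw [hL]
    exact (affineMap_left_mem_coneOpen φ ⊥).2 hφ
  obtain ⟨n, M, ν, s, V, hn, hν, hs, hV, hVa, hxV⟩ := generic_mem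
  have equivariant : (toSpec K (affineScheme K (PowerSeries K)) ≫ affineMap K θ) • affineMap K φ =
      discRescale q ≫ affineMap K φ := by
    rw [toSpec_eq_affineMap, affineMap_comp, discRescale, affineMap_comp]
    refine affineMap_smul_affineMap _ fun i => (hθ i).trans ?_
    rw [← PowerSeries.coe_rescaleAlgHom]
    rfl
  have section_vertex (x : (affineScheme K K).left) :
      (discOrigin K ≫ affineMap K φ ≫ s).left x ∈ M.zeroLocus := by
    rw [← Category.assoc, discOrigin_comp_affineMap hφ₀]
    by_contra hne
    refine vertex_notMem_coneOpen x ?_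
    rw [← SetLike.mem_coe, ← hL]
    refine ⟨n, M, ν, s, V, hn, hν, hs, hV, hVa, ?_⟩
    rw [← SetLike.mem_coe, hV]
    exact hne
  have section_generic : (affineMap K φ ≫ s).left (⊥ : PrimeSpectrum (PowerSeries K)) ∉
      M.zeroLocus := by
    rwa [← SetLike.mem_coe, hV] at hxV
  obtain ⟨k, hk, hak⟩ := exists_pow_eq_of_isInvariantSection hν hs equivariant
    ⟨IsLocalRing.closedPoint K, section_vertex _⟩ ⟨_, section_generic⟩ he
    (hev.trans (discOrigin_comp_affineMap hφ₀).symm) ha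
  exact ⟨n, k, hn, hk, hak⟩

/-- The point of the torus with parameter `q` on the one-parameter subgroup `s ↦ (s⁻¹, s²)`. -/
def oneParameter (q : Kˣ) : AddMonoidAlgebra K (ℤ × ℤ) →ₐ[K] K := torusHom q⁻¹ (q ^ 2)

lemma oneParameter_weight (q : Kˣ) (i : Fin 4) :
    oneParameter q (AddMonoidAlgebra.single (weight i) (1 : K)) =
      ((q ^ (![-2, 3, 1, -4] i : ℤ) : Kˣ) : K) := by
  rw [oneParameter, torusHom_single, inv_zpow', ← zpow_natCast, ← zpow_mul, ← zpow_add]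
  congr 2
  fin_cases i <;> rfl

lemma algebraMap_pow_mul_X_pow (q : K) (m : ℕ) :
    algebraMap K (PowerSeries K) (q ^ m) * PowerSeries.X ^ m =
      PowerSeries.rescale q (PowerSeries.X ^ m : PowerSeries K) := by
  rw [map_pow, map_pow, PowerSeries.rescale_X, mul_pow]
  rfl

lemma exists_pow_eq_pow_of_oneParameter
    (hL : L.semistableLocus = (coneOpen K : Set (cone K).left)) {q : Kˣ}
    {e : affineScheme K K ⟶ L.total} (he : L.IsFrame e) (hev : e ≫ L.proj = vertex K) {a : K}
    (ha : affineMap K (oneParameter q) • e = toLine K a • e) :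
    ∃ n k : ℕ, 0 < n ∧ 0 < k ∧ a ^ n = (q : K) ^ k := by
  refine exists_pow_eq_of_curve hL
    (φ := coneHom ![0, PowerSeries.X ^ 3, PowerSeries.X ^ 1, 0] (by simp))
    (fun i => ?_) (by simp) (fun i => by fin_cases i <;> simp) he hev ha
  rw [coneHom_coord, oneParameter_weight]
  fin_cases i
  · simp
  · exact algebraMap_pow_mul_X_pow (q : K) 3
  · exact algebraMap_pow_mul_X_pow (q : K) 1
  · simp

lemma exists_pow_eq_inv_pow_of_oneParameter
    (hL : L.semistableLocus = (coneOpen K : Set (cone K).left)) {q : Kˣ}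
    {e : affineScheme K K ⟶ L.total} (he : L.IsFrame e) (hev : e ≫ L.proj = vertex K) {a : K}
    (ha : affineMap K (oneParameter q) • e = toLine K a • e) :
    ∃ n k : ℕ, 0 < n ∧ 0 < k ∧ a ^ n = ((q⁻¹ : Kˣ) : K) ^ k := by
  refine exists_pow_eq_of_curve hL
    (φ := coneHom ![PowerSeries.X ^ 2, 0, 0, PowerSeries.X ^ 4] (by simp))
    (fun i => ?_) (by simp) (fun i => by fin_cases i <;> simp) he hev ha
  have weight_inv : oneParameter q (AddMonoidAlgebra.single (weight i) (1 : K)) =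
      ((q⁻¹ ^ (![2, -3, -1, 4] i : ℤ) : Kˣ) : K) := by
    rw [oneParameter_weight, inv_zpow']
    fin_cases i <;> rfl
  rw [coneHom_coord, weight_inv]
  fin_cases i
  · exact algebraMap_pow_mul_X_pow ((q⁻¹ : Kˣ) : K) 2
  · simp
  · simp
  · exact algebraMap_pow_mul_X_pow ((q⁻¹ : Kˣ) : K) 4

theorem semistableLocus_ne_coneOpen {q : Kˣ} (hq : ¬ IsOfFinOrder q)
    (L : LinearizedLineBundle (torus K) (cone K)) :
    L.semistableLocus ≠ (coneOpen K : Set (cone K).left) := by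
  intro hL
  obtain ⟨e, hev, he⟩ := L.exists_isFrame_of_local (vertex K)
  obtain ⟨a, ha⟩ := he.exists_toLine_smul_eq (e' := affineMap K (oneParameter q) • e) (by
    rw [IsModHom.map_smul, hev, affineMap_smul_vertex])
  obtain ⟨n, k, -, hk, hpos⟩ := exists_pow_eq_pow_of_oneParameter hL he hev ha.symm
  obtain ⟨m, l, hm, -, hneg⟩ := exists_pow_eq_inv_pow_of_oneParameter hL he hev ha.symm
  refine hq (isOfFinOrder_iff_pow_eq_one.2
    ⟨k * m + l * n, Nat.add_pos_left (Nat.mul_pos hk hm) _, Units.ext ?_⟩)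
  calc (q : K) ^ (k * m + l * n) = ((q : K) ^ k) ^ m * ((q : K) ^ l) ^ n := by ring
    _ = (((q⁻¹ : Kˣ) : K) ^ l) ^ n * ((q : K) ^ l) ^ n := by rw [← hpos, pow_right_comm, hneg]
    _ = 1 := by rw [← mul_pow, ← mul_pow, q.inv_mul, one_pow, one_pow]

lemma exists_unit_not_isOfFinOrder (K : Type u) [Field K] [CharZero K] :
    ∃ q : Kˣ, ¬ IsOfFinOrder q := by
  refine ⟨Units.mk0 2 two_ne_zero, fun h => ?_⟩
  obtain ⟨n, hn, h_pow⟩ := isOfFinOrder_iff_pow_eq_one.1 h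
  have two_pow_eq_one : (2 : K) ^ n = 1 := by simpa using congrArg Units.val h_pow
  have nat_two_pow_eq_one : (2 : ℕ) ^ n = 1 := by exact_mod_cast two_pow_eq_one
  exact hn.ne' (by simpa using nat_two_pow_eq_one)

end Unstable

section BasicOpens

variable (K : Type u) [Field K]

lemma preimage_basicOpen_comor {A : Type u} [CommRing A] [Algebra K A] {W : KScheme K}
    (f : W ⟶ affineScheme K A) (a : A) :
    f.left ⁻¹ᵁ (PrimeSpectrum.basicOpen a : TopologicalSpace.Opens (PrimeSpectrum A)) =
      W.left.basicOpen (comor K f a) := by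
  have key {S : Scheme.{u}} (g : S ⟶ Spec (.of A)) : g ⁻¹ᵁ PrimeSpectrum.basicOpen a =
      S.basicOpen (((Scheme.ΓSpecIso (.of A)).inv ≫ g.appTop).hom a) :=
    (congrArg (g ⁻¹ᵁ ·) (basicOpen_eq_of_affine (R := .of A) a).symm).trans
      (Scheme.preimage_basicOpen_top g _)
  exact key f.left

lemma notMem_of_isUnit_comor {A : Type u} [CommRing A] [Algebra K A] {W : KScheme K}
    (f : W ⟶ affineScheme K A) {a : A} (h : IsUnit (comor K f a)) (x : W.left) :
    a ∉ (show PrimeSpectrum A from f.left x).asIdeal := by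
  have hx : x ∈ f.left ⁻¹ᵁ
      (PrimeSpectrum.basicOpen a : TopologicalSpace.Opens (PrimeSpectrum A)) := by
    rw [preimage_basicOpen_comor, Scheme.basicOpen_of_isUnit _ h]
    trivial
  exact hx

end BasicOpens

section ProjectiveLine

attribute [local instance] MvPolynomial.gradedAlgebra

open HomogeneousLocalization

variable (K : Type u) [Field K]

/-- The grading of `K[x₀, x₁]` by degree, so that the projective line is `Proj (forms K)`. -/
abbrev forms : ℕ → Submodule K (MvPolynomial (Fin 2) K) :=
  MvPolynomial.homogeneousSubmodule (Fin 2) K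

lemma X_mem_forms (i : Fin 2) : (MvPolynomial.X i : MvPolynomial (Fin 2) K) ∈ forms K 1 :=
  MvPolynomial.isHomogeneous_X K i

lemma adjoin_range_X : Algebra.adjoin (forms K 0)
    (Set.range (MvPolynomial.X : Fin 2 → MvPolynomial (Fin 2) K)) = ⊤ := by
  refine eq_top_iff.2 fun p _ => ?_
  induction p using MvPolynomial.induction_on with
  | C a => exact Subalgebra.algebraMap_mem _ (algebraMap K (forms K 0) a)
  | add p q hp hq => exact add_mem (hp trivial) (hq trivial)
  | mul_X p i hp => exact mul_mem (hp trivial) (Algebra.subset_adjoin ⟨i, rfl⟩)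

instance awayAlgebra (f : MvPolynomial (Fin 2) K) : Algebra K (Away (forms K) f) where
  algebraMap := (algebraMap (forms K 0) (Away (forms K) f)).comp (algebraMap K (forms K 0))
  commutes' _ _ := mul_comm _ _
  smul_def' r x := by
    apply val_injective
    have h : (algebraMap (forms K 0) (Away (forms K) f) (algebraMap K (forms K 0) r)).val =
        algebraMap _ _ (MvPolynomial.C r) := Localization.mk_one_eq_algebraMap _
    rw [val_smul, RingHom.comp_apply, val_mul, h, Algebra.smul_def]
    rfl

lemma val_algebraMap {f : MvPolynomial (Fin 2) K} (r : K) :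
    (algebraMap K (Away (forms K) f) r).val =
      algebraMap (MvPolynomial (Fin 2) K) _ (MvPolynomial.C r) :=
  Localization.mk_one_eq_algebraMap _

/-- The open immersion of the locus `f ≠ 0` into the projective line, for a form `f`. -/
def awayIncl {f : MvPolynomial (Fin 2) K} {m : ℕ} (hf : f ∈ forms K m) (hm : 0 < m) :
    affineScheme K (Away (forms K) f) ⟶ projectiveLine K :=
  Over.homMk (Proj.awayι (forms K) f hf hm) (by
    refine (Proj.awayι_toSpecZero_assoc _ _ _ _ _).trans ?_
    rw [← Spec.map_comp]
    rfl)

instance awayIncl_isOpenImmersion {f : MvPolynomial (Fin 2) K} {m : ℕ} (hf : f ∈ forms K m)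
    (hm : 0 < m) : IsOpenImmersion (awayIncl K hf hm).left :=
  inferInstanceAs (IsOpenImmersion (Proj.awayι (forms K) f hf hm))

/-- Restriction of functions from the locus `f ≠ 0` to the locus `f * g ≠ 0`. -/
def awayRestrict (f : MvPolynomial (Fin 2) K) {g x : MvPolynomial (Fin 2) K} {m : ℕ}
    (hg : g ∈ forms K m) (hx : x = f * g) : Away (forms K) f →ₐ[K] Away (forms K) x :=
  { awayMap (forms K) hg hx with
    commutes' r := awayMap_fromZeroRingHom _ hg hx (algebraMap K (forms K 0) r) }

lemma exists_awayRestrict_of_comp_awayIncl {f g x : MvPolynomial (Fin 2) K} {m n : ℕ}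
    (hf : f ∈ forms K m) (hm : 0 < m) (hg : g ∈ forms K n) (hn : 0 < n) (hx : x = f * g)
    {W : KScheme K} {a : W ⟶ affineScheme K (Away (forms K) f)}
    {b : W ⟶ affineScheme K (Away (forms K) g)}
    (h : a ≫ awayIncl K hf hm = b ≫ awayIncl K hg hn) :
    ∃ k : W ⟶ affineScheme K (Away (forms K) x), k ≫ affineMap K (awayRestrict K f hg hx) = a ∧
      k ≫ affineMap K (awayRestrict K g hf (hx.trans (mul_comm f g))) = b := by
  have key {S : Scheme.{u}} (a : S ⟶ Spec (.of (Away (forms K) f)))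
      (b : S ⟶ Spec (.of (Away (forms K) g)))
      (h : a ≫ Proj.awayι (forms K) f hf hm = b ≫ Proj.awayι (forms K) g hg hn) :
      ∃ k : S ⟶ Spec (.of (Away (forms K) x)),
        k ≫ Spec.map (CommRingCat.ofHom (awayMap (forms K) hg hx)) = a ∧
        k ≫ Spec.map (CommRingCat.ofHom (awayMap (forms K) hf (hx.trans (mul_comm f g)))) = b :=
    ⟨Limits.pullback.lift a b h ≫ (Proj.pullbackAwayιIso (forms K) hf hm hg hn hx).hom,
      by rw [Category.assoc, Proj.pullbackAwayιIso_hom_SpecMap_awayMap_left,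
        Limits.pullback.lift_fst],
      by rw [Category.assoc, Proj.pullbackAwayιIso_hom_SpecMap_awayMap_right,
        Limits.pullback.lift_snd]⟩
  obtain ⟨k, hka, hkb⟩ := key a.left b.left congr(($h).left)
  let k' : W ⟶ affineScheme K (Away (forms K) x) := Over.homMk k
    ((congrArg (k ≫ ·) (Over.w (affineMap K (awayRestrict K f hg hx))).symm).trans
      ((Category.assoc _ _ _).symm.trans ((congrArg (· ≫ _) hka).trans (Over.w a))))
  refine ⟨k', ?_, ?_⟩ <;> ext1
  · exact hka
  · exact hkb

/-- The ring of functions on the standard chart `xᵢ ≠ 0` of the projective line. -/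
abbrev chartRing (i : Fin 2) : Type u := Away (forms K) (MvPolynomial.X i)

/-- The function `xⱼ / xᵢ` on the chart `xᵢ ≠ 0`. -/
abbrev chartRatio (i j : Fin 2) : chartRing K i :=
  Away.isLocalizationElem (X_mem_forms K i) (X_mem_forms K j)

variable {K}

lemma mk_prod_X_pow {i j : Fin 2} (hij : i ≠ j) {n : ℕ} {e : Fin 2 → ℕ} (he : ∑ k, e k = n)
    (hm : ∏ k, MvPolynomial.X k ^ e k ∈ forms K (n • 1)) :
    Away.mk (forms K) (X_mem_forms K i) n (∏ k, MvPolynomial.X k ^ e k) hm =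
      chartRatio K i j ^ e j := by
  have hsum : ∑ k, e k = e i + e j := by
    rw [Fin.sum_univ_two]
    fin_cases i <;> fin_cases j <;> first | exact absurd rfl hij | rfl | exact add_comm _ _
  have hprod : ∏ k, (MvPolynomial.X k : MvPolynomial (Fin 2) K) ^ e k =
      MvPolynomial.X i ^ e i * MvPolynomial.X j ^ e j := by
    rw [Fin.prod_univ_two]
    fin_cases i <;> fin_cases j <;> first | exact absurd rfl hij | rfl | exact mul_comm _ _
  apply val_injective
  rw [val_pow, Away.val_mk, Away.val_mk, Localization.mk_pow, Localization.mk_eq_mk_iff,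
    Localization.r_iff_exists]
  refine ⟨1, ?_⟩
  simp only [hprod, ← he, hsum, OneMemClass.coe_one, SubmonoidClass.coe_pow, pow_one]
  ring

lemma aeval_chartRatio_surjective {i j : Fin 2} (hij : i ≠ j) :
    Function.Surjective (Polynomial.aeval (R := K) (chartRatio K i j)) := by
  intro x
  have hx : x ∈ (⊤ : Submodule (forms K 0) (chartRing K i)) := trivial
  rw [← Away.span_mk_prod_pow_eq_top (X_mem_forms K i) MvPolynomial.X (adjoin_range_X K)
    (fun _ => 1) (X_mem_forms K)] at hx
  induction hx using Submodule.span_induction with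
  | mem x hx =>
    obtain ⟨n, e, he, rfl⟩ := hx
    refine ⟨Polynomial.X ^ e j, ?_⟩
    rw [map_pow, Polynomial.aeval_X]
    exact (mk_prod_X_pow hij (by simpa using he) _).symm
  | zero => exact ⟨0, map_zero _⟩
  | add x y _ _ hx hy =>
    obtain ⟨⟨p, rfl⟩, q, rfl⟩ := And.intro hx hy
    exact ⟨p + q, map_add _ _ _⟩
  | smul r x _ hx =>
    obtain ⟨p, rfl⟩ := hx
    obtain ⟨c, hc⟩ : ∃ c, algebraMap K _ c = r.1 :=
      Submodule.mem_one.1 ((MvPolynomial.homogeneousSubmodule_zero _).le r.2)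
    obtain rfl : algebraMap K (forms K 0) c = r := Subtype.ext hc
    refine ⟨c • p, ?_⟩
    rw [map_smul]
    exact Algebra.smul_def (A := chartRing K i) c _

lemma exists_algHom_chartRatio {i j : Fin 2} (hij : i ≠ j) :
    ∃ l : chartRing K i →ₐ[K] Polynomial K, l (chartRatio K i j) = Polynomial.X := by
  let dehomogenize : MvPolynomial (Fin 2) K →ₐ[K] Polynomial K :=
    MvPolynomial.aeval fun k => if k = i then 1 else Polynomial.X
  have hu : IsUnit (dehomogenize.toRingHom (MvPolynomial.X i)) := by
    simp [dehomogenize]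
  let l : Localization.Away (MvPolynomial.X i : MvPolynomial (Fin 2) K) →+* Polynomial K :=
    IsLocalization.Away.lift _ hu
  have hl (a : MvPolynomial (Fin 2) K) : l (algebraMap _ _ a) = dehomogenize a :=
    IsLocalization.Away.lift_eq _ hu a
  refine ⟨{ l.comp (algebraMap (chartRing K i) _) with commutes' := fun r => ?_ }, ?_⟩
  · change l (algebraMap K (chartRing K i) r).val = _
    rw [val_algebraMap, hl]
    exact dehomogenize.commutes r
  · change l (chartRatio K i j).val = _
    have h : algebraMap (MvPolynomial (Fin 2) K) (Localization.Away (MvPolynomial.X i))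
        (MvPolynomial.X i) * (chartRatio K i j).val =
          algebraMap (MvPolynomial (Fin 2) K) _ (MvPolynomial.X j) := by
      rw [Away.val_mk, Localization.mk_eq_mk', mul_comm]
      simp
    simpa [hl, dehomogenize, hij.symm] using congr(l $h)

lemma aeval_chartRatio_injective {i j : Fin 2} (hij : i ≠ j) :
    Function.Injective (Polynomial.aeval (R := K) (chartRatio K i j)) := by
  obtain ⟨l, hl⟩ := exists_algHom_chartRatio (K := K) hij
  refine Function.LeftInverse.injective (g := l) fun p => ?_
  rw [← Polynomial.aeval_algHom_apply, hl, Polynomial.aeval_X_left_apply]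

variable (K) in
/-- The identification of the ring of functions on a chart with a polynomial ring, the variable
being the function `xⱼ / xᵢ`. -/
def chartEquiv {i j : Fin 2} (hij : i ≠ j) : Polynomial K ≃ₐ[K] chartRing K i :=
  AlgEquiv.ofBijective (Polynomial.aeval (chartRatio K i j))
    ⟨aeval_chartRatio_injective hij, aeval_chartRatio_surjective hij⟩

@[simp]
lemma chartEquiv_X {i j : Fin 2} (hij : i ≠ j) :
    chartEquiv K hij Polynomial.X = chartRatio K i j :=
  Polynomial.aeval_X _

lemma awayRestrict_chartRatio_mul (i j : Fin 2) :
    awayRestrict K (MvPolynomial.X i) (X_mem_forms K j) rfl (chartRatio K i j) *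
      awayRestrict K (MvPolynomial.X j) (X_mem_forms K i) (mul_comm _ _) (chartRatio K j i) =
        1 := by
  have h : awayMap (forms K) (X_mem_forms K j) rfl (chartRatio K i j) *
      awayMap (forms K) (X_mem_forms K i) (mul_comm _ _) (chartRatio K j i) = 1 := by
    rw [awayMap_mk, awayMap_mk]
    apply val_injective
    rw [val_mul, val_one, Away.val_mk, Away.val_mk, Localization.mk_mul, ← Localization.mk_one,
      Localization.mk_eq_mk_iff, Localization.r_iff_exists]
    refine ⟨1, ?_⟩
    simp only [OneMemClass.coe_one, Submonoid.coe_mul]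
    ring
  exact h

variable (K)

/-- The standard open subset `xᵢ ≠ 0` of the projective line. -/
def chartOpen (i : Fin 2) : (projectiveLine K).left.Opens :=
  Proj.basicOpen (forms K) (MvPolynomial.X i)

lemma isAffineOpen_chartOpen (i : Fin 2) : IsAffineOpen (chartOpen K i) :=
  Proj.isAffineOpen_basicOpen _ _ (X_mem_forms K i) one_pos

lemma iSup_chartOpen : ⨆ i, chartOpen K i = ⊤ :=
  Proj.iSup_basicOpen_eq_top' (forms K) MvPolynomial.X (fun i => ⟨1, X_mem_forms K i⟩)
    (adjoin_range_X K)

/-- The open immersion `𝔸¹ ⟶ ℙ¹` onto `xᵢ ≠ 0` with coordinate `xⱼ / xᵢ`. -/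
def chart {i j : Fin 2} (hij : i ≠ j) : affineScheme K (Polynomial K) ⟶ projectiveLine K :=
  (affineIso K (chartEquiv K hij)).inv ≫ awayIncl K (X_mem_forms K i) one_pos

instance chart_isOpenImmersion {i j : Fin 2} (hij : i ≠ j) : IsOpenImmersion (chart K hij).left :=
  inferInstanceAs (IsOpenImmersion ((affineIso K (chartEquiv K hij)).inv.left ≫
    (awayIncl K (X_mem_forms K i) one_pos).left))

lemma range_chart {i j : Fin 2} (hij : i ≠ j) :
    Set.range (chart K hij).left = (chartOpen K i : Set (projectiveLine K).left) := by
  have h : Set.range (chart K hij).left =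
      Set.range (awayIncl K (X_mem_forms K i) one_pos).left := by
    have hsurj : Function.Surjective (affineIso K (chartEquiv K hij)).inv.left :=
      Scheme.Hom.surjective _
    rw [← hsurj.range_comp]
    rfl
  exact h.trans congr(SetLike.coe $(Proj.opensRange_awayι (forms K) _ (X_mem_forms K i) one_pos))

lemma chart_mem_chartOpen_iff {i j : Fin 2} (hij : i ≠ j) (x : PrimeSpectrum (Polynomial K)) :
    (chart K hij).left x ∈ chartOpen K j ↔ Polynomial.X ∉ x.asIdeal := by
  let y : PrimeSpectrum (chartRing K i) := (affineIso K (chartEquiv K hij)).inv.left x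
  have hy : y ∈ Proj.awayι (forms K) _ (X_mem_forms K i) one_pos ⁻¹ᵁ chartOpen K j ↔
      chartRatio K i j ∉ y.asIdeal := by
    rw [chartOpen, Proj.awayι_preimage_basicOpen (forms K) _ _ (X_mem_forms K j) one_pos]
    rfl
  have hyx : chartRatio K i j ∈ y.asIdeal ↔
      (chartEquiv K hij).symm (chartRatio K i j) ∈ x.asIdeal := Iff.rfl
  rw [← chartEquiv_X hij, AlgEquiv.symm_apply_apply] at hyx
  exact hy.trans (not_congr (by rw [← hyx, chartEquiv_X]))

lemma hom_ext_polynomial {W : KScheme K} {f g : W ⟶ affineScheme K (Polynomial K)}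
    (h : comor K f Polynomial.X = comor K g Polynomial.X) : f = g :=
  comor_inj K (Polynomial.ringHom_ext (fun r => comor_algebraMap K f g r) h)

lemma comor_mul_comor_of_comp_chart_eq {i j : Fin 2} (hij : i ≠ j) {W : KScheme K}
    {f g : W ⟶ affineScheme K (Polynomial K)} (h : f ≫ chart K hij = g ≫ chart K hij.symm) :
    comor K f Polynomial.X * comor K g Polynomial.X = 1 := by
  rw [chart, chart, ← Category.assoc, ← Category.assoc] at h
  obtain ⟨k, hkf, hkg⟩ := exists_awayRestrict_of_comp_awayIncl K _ _ _ _ rfl h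
  have hf : f = (k ≫ affineMap K (awayRestrict K _ _ _)) ≫ (affineIso K (chartEquiv K hij)).hom :=
    ((Iso.comp_inv_eq _).1 hkf.symm)
  have hg : g = (k ≫ affineMap K (awayRestrict K _ _ _)) ≫
      (affineIso K (chartEquiv K hij.symm)).hom := ((Iso.comp_inv_eq _).1 hkg.symm)
  have hX {l m : Fin 2} (hlm : l ≠ m) : (chartEquiv K hlm).toAlgHom Polynomial.X =
      chartRatio K l m := chartEquiv_X hlm
  rw [hf, hg, affineIso, affineIso, comor_comp_map, comor_comp_map, comor_comp_map, comor_comp_map,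
    hX, hX, ← map_mul, awayRestrict_chartRatio_mul, map_one]

theorem comp_chart_eq {i j : Fin 2} (hij : i ≠ j) {W : KScheme K}
    {f g : W ⟶ affineScheme K (Polynomial K)}
    (h : comor K f Polynomial.X * comor K g Polynomial.X = 1) :
    f ≫ chart K hij = g ≫ chart K hij.symm := by
  have hrange : Set.range (f ≫ chart K hij).left ⊆ Set.range (chart K hij.symm).left := by
    rw [range_chart]
    rintro _ ⟨x, rfl⟩
    exact (chart_mem_chartOpen_iff K hij _).2
      (notMem_of_isUnit_comor K f (IsUnit.of_mul_eq_one _ h) x)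
  have hfac := immersionLift_comp (chart K hij.symm) (f ≫ chart K hij) hrange
  rw [← hfac]
  congr 1
  apply hom_ext_polynomial
  exact left_inv_eq_right_inv
    ((mul_comm _ _).trans (comor_mul_comor_of_comp_chart_eq K hij hfac.symm)) h

end ProjectiveLine

section Sections

variable {X Y Z : Scheme.{u}}

/-- Restriction of functions to a smaller open set, as a ring homomorphism. -/
def res {U V : X.Opens} (h : V ≤ U) : Γ(X, U) →+* Γ(X, V) := (X.presheaf.map (homOfLE h).op).hom

/-- Pullback of functions on `U` along `f` to an open subset `V` of the preimage of `U`. -/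
def pull (f : X ⟶ Y) (U : Y.Opens) (V : X.Opens) (e : V ≤ f ⁻¹ᵁ U) : Γ(Y, U) →+* Γ(X, V) :=
  (f.appLE U V e).hom

lemma res_res {U V W : X.Opens} (h : V ≤ U) (h' : W ≤ V) (x : Γ(X, U)) :
    res h' (res h x) = res (h'.trans h) x :=
  congr(($((X.presheaf.map_comp (homOfLE h).op (homOfLE h').op).symm)).hom x)

lemma pull_res (f : X ⟶ Y) {U U' : Y.Opens} {V : X.Opens} (h : U' ≤ U) (e : V ≤ f ⁻¹ᵁ U')
    (x : Γ(Y, U)) : pull f U' V e (res h x) = pull f U V (e.trans (f.preimage_mono h)) x :=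
  congr(($(f.map_appLE e (homOfLE h).op)).hom x)

lemma res_pull (f : X ⟶ Y) {U : Y.Opens} {V V' : X.Opens} (h : V' ≤ V) (e : V ≤ f ⁻¹ᵁ U)
    (x : Γ(Y, U)) : res h (pull f U V e x) = pull f U V' (h.trans e) x :=
  congr(($(f.appLE_map e (homOfLE h).op)).hom x)

lemma pull_pull (f : X ⟶ Y) (g : Y ⟶ Z) {U : Z.Opens} {V : Y.Opens} {W : X.Opens}
    (e : V ≤ g ⁻¹ᵁ U) (e' : W ≤ f ⁻¹ᵁ V) (x : Γ(Z, U)) :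
    pull f V W e' (pull g U V e x) = pull (f ≫ g) U W (e'.trans (f.preimage_mono e)) x :=
  congr(($(Scheme.Hom.appLE_comp_appLE f g U V W e e')).hom x)

lemma pull_congr {f g : X ⟶ Y} (h : f = g) {U : Y.Opens} {V : X.Opens} (e : V ≤ f ⁻¹ᵁ U)
    (e' : V ≤ g ⁻¹ᵁ U) (x : Γ(Y, U)) : pull f U V e x = pull g U V e' x := by
  subst h
  rfl

lemma app_eq_pull (f : X ⟶ Y) (U : Y.Opens) (x : Γ(Y, U)) : f.app U x = pull f U _ le_rfl x :=
  congr(($(f.app_eq_appLE)).hom x)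

lemma eq_of_res_eq {I : Type*} {U : I → X.Opens} {V : X.Opens} (h : ∀ i, U i ≤ V)
    (hV : V ≤ iSup U) {x y : Γ(X, V)} (hxy : ∀ i, res (h i) x = res (h i) y) : x = y :=
  X.sheaf.eq_of_locally_eq' U V (fun i => homOfLE (h i)) hV x y hxy

lemma exists_res_eq {I : Type*} {U : I → X.Opens} {V : X.Opens} (h : ∀ i, U i ≤ V)
    (hV : V ≤ iSup U) (x : ∀ i, Γ(X, U i))
    (hx : ∀ i j, res (inf_le_left : U i ⊓ U j ≤ U i) (x i) = res inf_le_right (x j)) :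
    ∃ y : Γ(X, V), ∀ i, res (h i) y = x i :=
  (X.sheaf.existsUnique_gluing' U V (fun i => homOfLE (h i)) hV x hx).exists

lemma isUnit_res_basicOpen {U V : X.Opens} (b : Γ(X, U)) (h : V ≤ U) (hV : V ≤ X.basicOpen b) :
    IsUnit (res h b) := by
  have h1 := (X.toRingedSpace.isUnit_res_basicOpen b).map (res hV)
  have h2 : res hV (res (X.basicOpen_le b) b) = res h b := res_res _ _ _
  rw [← h2]
  exact h1

lemma exists_mul_eq_res {U V : X.Opens} (hU : IsAffineOpen U) (b : Γ(X, U)) (h : V ≤ U)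
    (hV : V = X.basicOpen b) (x : Γ(X, V)) :
    ∃ (n : ℕ) (r : Γ(X, U)), x * res h b ^ n = res h r := by
  let := (X.presheaf.map (homOfLE h).op).hom.toAlgebra
  have hloc := hU.isLocalization_of_eq_basicOpen b (homOfLE h) hV
  obtain ⟨n, r, hr⟩ := IsLocalization.Away.surj b x
  exact ⟨n, r, hr⟩

lemma exists_pow_mul_eq_zero {U V : X.Opens} (hU : IsCompact (U : Set X)) (x b : Γ(X, U))
    (h : V ≤ U) (hV : V = X.basicOpen b) (hx : res h x = 0) : ∃ n : ℕ, b ^ n * x = 0 := by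
  subst hV
  exact exists_pow_mul_eq_zero_of_res_basicOpen_eq_zero_of_isCompact X hU x b hx

end Sections

section Descent

variable {X Y Z : Scheme.{u}} (o₁ o₂ : Z ⟶ X) (p : X ⟶ Y)

/-- The pullbacks of `f` along `o₁` and `o₂` agree wherever both are defined. For the action and
the projection `G × X ⟶ X` this says that `f` is invariant. -/
def IsEqualized {U : X.Opens} (f : Γ(X, U)) : Prop :=
  pull o₁ U (o₁ ⁻¹ᵁ U ⊓ o₂ ⁻¹ᵁ U) inf_le_left f = pull o₂ U (o₁ ⁻¹ᵁ U ⊓ o₂ ⁻¹ᵁ U) inf_le_right f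

/-- The functions on `V` are exactly the functions on its preimage on which `o₁` and `o₂` agree. -/
def DescendsOver (V : Y.Opens) : Prop :=
  Function.Injective (pull p V (p ⁻¹ᵁ V) le_rfl) ∧
    ∀ f : Γ(X, p ⁻¹ᵁ V), IsEqualized o₁ o₂ f → ∃ h, pull p V (p ⁻¹ᵁ V) le_rfl h = f

variable {o₁ o₂ p}

lemma IsEqualized.pull_eq {U : X.Opens} {f : Γ(X, U)} (hf : IsEqualized o₁ o₂ f) {W : Z.Opens}
    (e₁ : W ≤ o₁ ⁻¹ᵁ U) (e₂ : W ≤ o₂ ⁻¹ᵁ U) : pull o₁ U W e₁ f = pull o₂ U W e₂ f := by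
  have h := congr(res (le_inf e₁ e₂) $hf)
  rwa [res_pull, res_pull] at h

lemma IsEqualized.restrict {U U' : X.Opens} {f : Γ(X, U)} (hf : IsEqualized o₁ o₂ f)
    (h : U' ≤ U) : IsEqualized o₁ o₂ (res h f) := by
  rw [IsEqualized, pull_res, pull_res]
  exact hf.pull_eq _ _

lemma IsEqualized.mul {U : X.Opens} {f g : Γ(X, U)} (hf : IsEqualized o₁ o₂ f)
    (hg : IsEqualized o₁ o₂ g) : IsEqualized o₁ o₂ (f * g) := by
  rw [IsEqualized, map_mul, map_mul, hf, hg]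

lemma IsEqualized.pow {U : X.Opens} {f : Γ(X, U)} (hf : IsEqualized o₁ o₂ f) (n : ℕ) :
    IsEqualized o₁ o₂ (f ^ n) := by
  rw [IsEqualized, map_pow, map_pow, hf]

lemma isEqualized_pull (hp : o₁ ≫ p = o₂ ≫ p) (V : Y.Opens) (h : Γ(Y, V)) :
    IsEqualized o₁ o₂ (pull p V (p ⁻¹ᵁ V) le_rfl h) := by
  rw [IsEqualized, pull_pull, pull_pull]
  exact pull_congr hp _ _ _

/-- The difference of the two pullbacks of `r` vanishes where `b` does not, so it is annihilated by
a power of the pullback of `b`. -/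
lemma IsEqualized.exists_pow_mul {U : X.Opens}
    (hW : IsCompact ((o₁ ⁻¹ᵁ U ⊓ o₂ ⁻¹ᵁ U : Z.Opens) : Set Z)) {b : Γ(X, U)}
    (hb : IsEqualized o₁ o₂ b) {r : Γ(X, U)}
    (hr : IsEqualized o₁ o₂ (res (X.basicOpen_le b) r)) :
    ∃ m : ℕ, IsEqualized o₁ o₂ (b ^ m * r) := by
  let W : Z.Opens := o₁ ⁻¹ᵁ U ⊓ o₂ ⁻¹ᵁ U
  let β := pull o₁ U W inf_le_left b
  have e₁ : Z.basicOpen β ≤ o₁ ⁻¹ᵁ X.basicOpen b :=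
    (Scheme.basicOpen_appLE _ _ _ _ _).le.trans inf_le_right
  have e₂ : Z.basicOpen β ≤ o₂ ⁻¹ᵁ X.basicOpen b := by
    rw [show β = pull o₂ U W inf_le_right b from hb]
    exact (Scheme.basicOpen_appLE _ _ _ _ _).le.trans inf_le_right
  have hd : res (Z.basicOpen_le β) (pull o₁ U W inf_le_left r - pull o₂ U W inf_le_right r)
      = 0 := by
    have h := hr.pull_eq e₁ e₂
    rw [pull_res, pull_res] at h
    rw [map_sub, res_pull, res_pull, h, sub_self]
  obtain ⟨m, hm⟩ := exists_pow_mul_eq_zero hW _ β (Z.basicOpen_le β) rfl hd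
  refine ⟨m, ?_⟩
  rw [IsEqualized, map_mul, map_mul, map_pow, map_pow, ← hb, ← sub_eq_zero, ← mul_sub]
  exact hm

lemma pull_res_eq_res_pull (f : X ⟶ Y) {V V' : Y.Opens} (h : V' ≤ V) (r : Γ(Y, V)) :
    pull f V' (f ⁻¹ᵁ V') le_rfl (res h r) =
      res (f.preimage_mono h) (pull f V (f ⁻¹ᵁ V) le_rfl r) := by
  rw [pull_res, res_pull]

lemma preimage_basicOpen_eq (f : X ⟶ Y) {V : Y.Opens} (b : Γ(Y, V)) :
    f ⁻¹ᵁ Y.basicOpen b = X.basicOpen (pull f V (f ⁻¹ᵁ V) le_rfl b) := by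
  rw [← app_eq_pull, Scheme.preimage_basicOpen]

lemma injective_pull_basicOpen {V : Y.Opens} (hV : IsAffineOpen V) (hU : IsAffineOpen (p ⁻¹ᵁ V))
    (h : Function.Injective (pull p V (p ⁻¹ᵁ V) le_rfl)) (b : Γ(Y, V)) :
    Function.Injective (pull p (Y.basicOpen b) (p ⁻¹ᵁ Y.basicOpen b) le_rfl) := by
  have hub : IsUnit (res (Y.basicOpen_le b) b) := isUnit_res_basicOpen b _ le_rfl
  rw [injective_iff_map_eq_zero]
  intro x hx
  obtain ⟨n, r, hr⟩ := exists_mul_eq_res hV b (Y.basicOpen_le b) rfl x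
  have hr0 : res (p.preimage_mono (Y.basicOpen_le b)) (pull p V (p ⁻¹ᵁ V) le_rfl r) = 0 := by
    rw [← pull_res_eq_res_pull p (Y.basicOpen_le b), ← hr, map_mul, hx, zero_mul]
  obtain ⟨m, hm⟩ := exists_pow_mul_eq_zero hU.isCompact _ _ _ (preimage_basicOpen_eq p b) hr0
  rw [← map_pow, ← map_mul] at hm
  have hbr := congr(res (Y.basicOpen_le b) $((injective_iff_map_eq_zero _).1 h _ hm))
  rwa [map_mul, map_pow, map_zero, (hub.pow m).mul_right_eq_zero, ← hr,
    (hub.pow n).mul_left_eq_zero] at hbr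

lemma DescendsOver.basicOpen (hp : o₁ ≫ p = o₂ ≫ p) {V : Y.Opens} (hV : IsAffineOpen V)
    (hU : IsAffineOpen (p ⁻¹ᵁ V))
    (hW : IsCompact ((o₁ ⁻¹ᵁ (p ⁻¹ᵁ V) ⊓ o₂ ⁻¹ᵁ (p ⁻¹ᵁ V) : Z.Opens) : Set Z))
    (h : DescendsOver o₁ o₂ p V) (b : Γ(Y, V)) : DescendsOver o₁ o₂ p (Y.basicOpen b) := by
  refine ⟨injective_pull_basicOpen hV hU h.1 b, ?_⟩
  set b' := pull p V (p ⁻¹ᵁ V) le_rfl b with hb'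
  have hb'_eq : IsEqualized o₁ o₂ b' := isEqualized_pull hp V b
  have hD : Y.basicOpen b ≤ V := Y.basicOpen_le b
  have hpull (s : Γ(Y, V)) := pull_res_eq_res_pull p hD s
  have hub : IsUnit (res hD b) := isUnit_res_basicOpen b hD le_rfl
  generalize p.preimage_mono hD = hpD at hpull
  generalize (le_rfl : p ⁻¹ᵁ Y.basicOpen b ≤ _) = hrfl at hpull
  have hpb : p ⁻¹ᵁ Y.basicOpen b = X.basicOpen b' := preimage_basicOpen_eq p b
  intro f hf
  obtain ⟨n, r, hr⟩ := exists_mul_eq_res hU b' hpD hpb f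
  have hr_eq : IsEqualized o₁ o₂ (res (X.basicOpen_le b') r) := by
    have := (hf.mul ((hb'_eq.restrict hpD).pow n)).restrict hpb.ge
    rwa [hr, res_res] at this
  obtain ⟨m, hm⟩ := hb'_eq.exists_pow_mul hW hr_eq
  obtain ⟨g, hg⟩ := h.2 _ hm
  obtain ⟨c, hc⟩ := (hub.pow (n + m)).exists_right_inv
  refine ⟨res hD g * c, ?_⟩
  have hc' := congr(pull p (Y.basicOpen b) (p ⁻¹ᵁ Y.basicOpen b) hrfl $hc)
  rw [map_mul, map_pow, map_one, hpull, ← hb', pow_add] at hc'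
  rw [map_mul, hpull, hg, map_mul, map_pow, ← hr]
  linear_combination f * hc'

lemma injective_pull_of_locally
    (h : ∀ (V : Y.Opens), ∀ y ∈ V, ∃ D ≤ V, y ∈ D ∧ Function.Injective (pull p D (p ⁻¹ᵁ D) le_rfl))
    (V : Y.Opens) : Function.Injective (pull p V (p ⁻¹ᵁ V) le_rfl) := by
  choose D hDV hyD hD using fun y : V => h V y y.2
  intro s t hst
  refine eq_of_res_eq hDV (fun y hy => TopologicalSpace.Opens.mem_iSup.2 ⟨⟨y, hy⟩, hyD _⟩)
    fun y => hD y ?_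
  rw [pull_res_eq_res_pull, pull_res_eq_res_pull, hst]

lemma descendsOver_of_locally
    (h : ∀ (V : Y.Opens), ∀ y ∈ V, ∃ D ≤ V, y ∈ D ∧ DescendsOver o₁ o₂ p D) (V : Y.Opens) :
    DescendsOver o₁ o₂ p V := by
  have hinj := injective_pull_of_locally (p := p) fun V y hy =>
    (h V y hy).imp fun D hD => ⟨hD.1, hD.2.1, hD.2.2.1⟩
  refine ⟨hinj V, fun f hf => ?_⟩
  choose D hDV hyD hD using fun y : V => h V y y.2
  choose g hg using fun y => (hD y).2 _ (hf.restrict (p.preimage_mono (hDV y)))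
  have hg_res (x : V) {E : Y.Opens} (hx : E ≤ D x) : pull p E (p ⁻¹ᵁ E) le_rfl (res hx (g x)) =
      res (p.preimage_mono (hx.trans (hDV x))) f := by
    rw [pull_res_eq_res_pull, hg, res_res]
  obtain ⟨s, hs⟩ := exists_res_eq hDV
    (fun y hy => TopologicalSpace.Opens.mem_iSup.2 ⟨⟨y, hy⟩, hyD _⟩) g
    fun x y => hinj _ ((hg_res x inf_le_left).trans (hg_res y inf_le_right).symm)
  refine ⟨s, eq_of_res_eq (U := fun y => p ⁻¹ᵁ D y) (fun y => p.preimage_mono (hDV y))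
    (fun x hx => TopologicalSpace.Opens.mem_iSup.2 ⟨⟨p x, hx⟩, hyD _⟩) fun y => ?_⟩
  rw [← hg y, ← hs y, pull_res_eq_res_pull]

end Descent

section GoodQuotient

variable {K : Type u} [Field K] {G : KScheme K} [MonObj G] {X Y : KScheme K} [ModObj G X]

theorem isGoodQuotient_of_cover [QuasiCompact (snd G X).left] {p : X ⟶ Y}
    (hp : act G X ≫ p = snd G X ≫ p) {J : Type*} (V : J → Y.left.Opens) (hV : ⨆ i, V i = ⊤)
    (hVaff : ∀ i, IsAffineOpen (V i)) (hU : ∀ i, IsAffineOpen (p.left ⁻¹ᵁ V i))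
    (h : ∀ i, DescendsOver (act G X).left (snd G X).left p.left (V i)) :
    IsGoodQuotient G p := by
  have hp' : (act G X).left ≫ p.left = (snd G X).left ≫ p.left := congr(($hp).left)
  have hcompact (i : J) : IsCompact (((act G X).left ⁻¹ᵁ (p.left ⁻¹ᵁ V i) ⊓
      (snd G X).left ⁻¹ᵁ (p.left ⁻¹ᵁ V i) : (G ⊗ X).left.Opens) : Set (G ⊗ X).left) := by
    have he : (act G X).left ⁻¹ᵁ (p.left ⁻¹ᵁ V i) ⊓ (snd G X).left ⁻¹ᵁ (p.left ⁻¹ᵁ V i) =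
        (snd G X).left ⁻¹ᵁ (p.left ⁻¹ᵁ V i) := by
      rw [← Scheme.Hom.comp_preimage, ← Scheme.Hom.comp_preimage, hp', inf_idem]
    rw [he]
    exact QuasiCompact.isCompact_preimage (f := (snd G X).left) _ (p.left ⁻¹ᵁ V i).2
      (hU i).isCompact
  have hdesc := descendsOver_of_locally (o₁ := (act G X).left) (o₂ := (snd G X).left)
    (p := p.left) fun W y hy => by
      obtain ⟨i, hi⟩ := TopologicalSpace.Opens.mem_iSup.1 (hV.ge (Set.mem_univ y))
      obtain ⟨b, hbW, hyb⟩ := (hVaff i).exists_basicOpen_le ⟨y, hy⟩ hi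
      exact ⟨_, hbW, hyb, (h i).basicOpen hp' (hVaff i) (hU i) (hcompact i) b⟩
  have happ (W : Y.left.Opens) :
      (p.left.app W : Γ(Y.left, W) → Γ(X.left, p.left ⁻¹ᵁ W)) = pull p.left W _ le_rfl :=
    funext (app_eq_pull p.left W)
  refine ⟨isAffineHom_of_forall_exists_isAffineOpen _ fun y => ?_, hp, fun W => ?_, fun W f => ?_⟩
  · obtain ⟨i, hi⟩ := TopologicalSpace.Opens.mem_iSup.1 (hV.ge (Set.mem_univ y))
    exact ⟨V i, hi, hVaff i, hU i⟩
  · rw [happ]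
    exact (hdesc W).1
  · rw [happ]
    refine ⟨?_, fun hf => (hdesc W).2 f hf⟩
    rintro ⟨g, rfl⟩
    exact isEqualized_pull hp' W g

end GoodQuotient

section Action

variable (K : Type u) [Field K]

/-- The symmetry of the cone that interchanges `z₁` with `z₂` and `z₃` with `z₄`. It interchanges
the two patches of `coneOpen`; writing the coordinates on the patch `i` as `z (patchIndex i k)`
allows treating both patches at once. -/
def patchIndex : Fin 2 → Fin 4 → Fin 4 := ![![0, 1, 2, 3], ![1, 0, 3, 2]]

/-- The functions `z₂z₃` and `z₁z₄` that define the two patches of `coneOpen`. -/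
def den (i : Fin 2) : coneRing K := coord K (patchIndex i 1) * coord K (patchIndex i 2)

variable {K}

lemma mem_coneOpen_iff_exists {W : KScheme K} (f : W ⟶ cone K) (x : W.left) :
    f.left x ∈ coneOpen K ↔ ∃ i, x ∈ W.left.basicOpen (comor K f (den K i)) := by
  rw [Fin.exists_fin_two, ← preimage_basicOpen_comor K, ← preimage_basicOpen_comor K]
  exact Iff.rfl

lemma isUnit_comor_single {W : KScheme K} (g : W ⟶ torus K) (w : ℤ × ℤ) :
    IsUnit (comor K g (AddMonoidAlgebra.single w 1)) := by
  refine IsUnit.map _ (IsUnit.of_mul_eq_one (AddMonoidAlgebra.single (-w) 1) ?_)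
  rw [AddMonoidAlgebra.single_mul_single, add_neg_cancel, _root_.mul_one]
  rfl

lemma smul_mem_coneOpen_iff {W : KScheme K} (g : W ⟶ torus K) (f : W ⟶ cone K) (x : W.left) :
    (g • f : W ⟶ cone K).left x ∈ coneOpen K ↔ f.left x ∈ coneOpen K := by
  have h (i : Fin 2) : W.left.basicOpen (comor K (g • f) (den K i)) =
      W.left.basicOpen (comor K f (den K i)) := by
    simp only [den, map_mul, comor_smul, Scheme.basicOpen_mul,
      Scheme.basicOpen_of_isUnit _ (isUnit_comor_single g _), top_inf_eq]
  simp_rw [mem_coneOpen_iff_exists, h]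

variable (K) in
/-- The open subset `coneOpen` of the cone as a scheme. -/
abbrev coneSub : KScheme K := openSub (cone K) (coneOpen K)

variable (K) in
/-- The inclusion of `coneOpen` into the cone. -/
abbrev coneIncl : coneSub K ⟶ cone K := openIncl (cone K) (coneOpen K)

lemma range_subset_of_comp {W : KScheme K} (f : W ⟶ cone K) (h : ∀ x, f.left x ∈ coneOpen K) :
    Set.range f.left ⊆ Set.range (coneIncl K).left := by
  rw [range_openIncl]
  rintro _ ⟨x, rfl⟩
  exact h x

lemma coneIncl_mem (x : (coneSub K).left) : (coneIncl K).left x ∈ coneOpen K := by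
  rw [← SetLike.mem_coe, ← range_openIncl]
  exact ⟨x, rfl⟩

variable (K) in
/-- The action morphism of the torus on `coneOpen`. -/
def subAct : torus K ⊗ coneSub K ⟶ coneSub K :=
  immersionLift (coneIncl K) (fst _ _ • (snd _ _ ≫ coneIncl K)) (range_subset_of_comp _ fun x => by
    rw [smul_mem_coneOpen_iff]
    exact coneIncl_mem _)

lemma lift_subAct {W : KScheme K} (g : W ⟶ torus K) (x : W ⟶ coneSub K) :
    (lift g x ≫ subAct K) ≫ coneIncl K = g • (x ≫ coneIncl K) := by
  rw [Category.assoc, subAct, immersionLift_comp, ModObj.comp_smul, lift_fst, lift_snd_assoc]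

/-- The torus action on `coneOpen`. -/
instance subAction (K : Type u) [Field K] : ModObj (torus K) (coneSub K) where
  smul := subAct K
  one_smul := by
    have h : η[torus K] ▷ coneSub K = lift (1 : _ ⟶ torus K) (snd _ _) := by
      ext1
      · rw [whiskerRight_fst, lift_fst, Hom.one_def]
        congr 1
      · rw [whiskerRight_snd, lift_snd]
    change η[torus K] ▷ coneSub K ≫ subAct K = (λ_ _).hom
    rw [h, ← cancel_mono (coneIncl K), lift_subAct, one_smul, leftUnitor_hom]
  mul_smul := by
    have h : μ[torus K] ▷ coneSub K =
        lift ((fst _ _ ≫ fst _ _) * (fst _ _ ≫ snd _ _)) (snd _ _) := by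
      rw [Hom.mul_def]
      ext1 <;> simp
    have h' : (α_ _ _ _).hom ≫ torus K ◁ subAct K =
        lift (fst _ _ ≫ fst _ _) (lift (fst _ _ ≫ snd _ _) (snd _ _) ≫ subAct K) := by
      ext1
      · simp
      · simp only [Category.assoc, whiskerLeft_snd, lift_snd]
        rw [← Category.assoc]
        congr 1
        ext1 <;> simp
    change μ[torus K] ▷ coneSub K ≫ subAct K =
      (α_ _ _ _).hom ≫ torus K ◁ subAct K ≫ subAct K
    rw [reassoc_of% h', h, ← cancel_mono (coneIncl K), lift_subAct, lift_subAct, lift_subAct,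
      SemigroupAction.mul_smul]

lemma smul_comp_coneIncl {W : KScheme K} (g : W ⟶ torus K) (x : W ⟶ coneSub K) :
    (g • x) ≫ coneIncl K = g • (x ≫ coneIncl K) := lift_subAct g x

instance coneIncl_isModHom (K : Type u) [Field K] : IsModHom (torus K) (coneIncl K) where
  smul_hom := by
    change subAct K ≫ coneIncl K = torus K ◁ coneIncl K ≫ torusAct K
    rw [subAct, immersionLift_comp]
    change lift _ _ ≫ torusAct K = _
    congr 1

end Action

section WeightVectors

variable {K : Type u} [Field K] {M : Type*} [AddCommGroup M] {A : Type u} [CommRing A]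
  [Algebra K A] {ρ : A →ₐ[K] AddMonoidAlgebra K M ⊗[K] A}

/-- With respect to the coaction `ρ` of the group algebra of the character group `M` of a torus,
`f` is a weight vector of weight `w`. -/
def IsWeightVector (ρ : A →ₐ[K] AddMonoidAlgebra K M ⊗[K] A) (w : M) (f : A) : Prop :=
  ρ f = AddMonoidAlgebra.single w (1 : K) ⊗ₜ[K] f

lemma isWeightVector_zero_iff {f : A} : IsWeightVector ρ 0 f ↔ ρ f = 1 ⊗ₜ[K] f := Iff.rfl

lemma IsWeightVector.mul {v w : M} {f g : A} (hf : IsWeightVector ρ v f)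
    (hg : IsWeightVector ρ w g) : IsWeightVector ρ (v + w) (f * g) := by
  rw [IsWeightVector, map_mul, hf, hg, Algebra.TensorProduct.tmul_mul_tmul,
    AddMonoidAlgebra.single_mul_single, _root_.mul_one]

lemma IsWeightVector.pow {w : M} {f : A} (hf : IsWeightVector ρ w f) (n : ℕ) :
    IsWeightVector ρ (n • w) (f ^ n) := by
  rw [IsWeightVector, map_pow, hf, Algebra.TensorProduct.tmul_pow, AddMonoidAlgebra.single_pow,
    one_pow]

lemma isUnit_single_tmul (w : M) {x : A} (hx : IsUnit x) :
    IsUnit (AddMonoidAlgebra.single w (1 : K) ⊗ₜ[K] x) := by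
  obtain ⟨x, rfl⟩ := hx
  refine IsUnit.of_mul_eq_one (AddMonoidAlgebra.single (-w) (1 : K) ⊗ₜ[K] ↑x⁻¹) ?_
  rw [Algebra.TensorProduct.tmul_mul_tmul, AddMonoidAlgebra.single_mul_single, add_neg_cancel,
    _root_.mul_one, Units.mul_inv]
  rfl

lemma IsWeightVector.inv {w : M} {x : Aˣ} (hx : IsWeightVector ρ w x) :
    IsWeightVector ρ (-w) (x⁻¹ : Aˣ) := by
  refine left_inv_eq_right_inv (a := ρ x) (by rw [← map_mul, Units.inv_mul, map_one]) ?_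
  rw [hx, Algebra.TensorProduct.tmul_mul_tmul, AddMonoidAlgebra.single_mul_single, add_neg_cancel,
    _root_.mul_one, Units.mul_inv]
  rfl

lemma IsWeightVector.zpow {w : M} {x : Aˣ} (hx : IsWeightVector ρ w x) :
    ∀ n : ℤ, IsWeightVector ρ (n • w) (x ^ n : Aˣ)
  | .ofNat n => by
    simpa only [Int.ofNat_eq_natCast, natCast_zsmul, zpow_natCast, Units.val_pow_eq_pow_val]
      using hx.pow n
  | .negSucc n => by
    rw [negSucc_zsmul, zpow_negSucc]
    exact IsWeightVector.inv (by simpa only [Units.val_pow_eq_pow_val] using hx.pow (n + 1))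

/-- The projection to the weight space of weight `0`. -/
def invariantPart (ρ : A →ₐ[K] AddMonoidAlgebra K M ⊗[K] A) : A →ₗ[K] A :=
  (TensorProduct.lid K A).toLinearMap ∘ₗ
    (Finsupp.lapply 0 ∘ₗ (AddMonoidAlgebra.coeffLinearEquiv K).toLinearMap).rTensor A ∘ₗ
      ρ.toLinearMap

open Classical in
lemma IsWeightVector.invariantPart_eq {w : M} {f : A} (hf : IsWeightVector ρ w f) :
    invariantPart ρ f = if w = 0 then f else 0 := by
  have h : invariantPart ρ f = (AddMonoidAlgebra.single w (1 : K)).coeff 0 • f := by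
    change TensorProduct.lid K A (LinearMap.rTensor A _ (ρ f)) = _
    rw [hf]
    rfl
  rw [h, AddMonoidAlgebra.coeff_single, Finsupp.single_apply]
  split_ifs <;> simp

lemma mem_of_isWeightVector_zero {J : Type*} {s : J → A} {wt : J → M}
    (hs : ∀ i, IsWeightVector ρ (wt i) (s i)) (hspan : Submodule.span K (Set.range s) = ⊤)
    {N : Submodule K A} (hN : ∀ i, wt i = 0 → s i ∈ N) {f : A} (hf : IsWeightVector ρ 0 f) :
    f ∈ N := by
  have invariantPart_mem : Submodule.span K (Set.range s) ≤ N.comap (invariantPart ρ) := by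
    rw [Submodule.span_le]
    rintro _ ⟨i, rfl⟩
    rw [SetLike.mem_coe, Submodule.mem_comap, (hs i).invariantPart_eq]
    split_ifs with h
    exacts [hN i h, N.zero_mem]
  have hfN := invariantPart_mem (hspan ▸ Submodule.mem_top : f ∈ _)
  rwa [Submodule.mem_comap, hf.invariantPart_eq, if_pos rfl] at hfN

end WeightVectors

section LaurentMonomials

variable {A : Type*} [CommRing A]

/-- The monomial `f ^ a * x ^ b * y ^ c`, as a function of `(a, b, c)`. -/
def laurentMonomial (f : A) (x y : Aˣ) : Multiplicative (ℕ × ℤ × ℤ) →* A where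
  toFun m := f ^ m.toAdd.1 * (x ^ m.toAdd.2.1 * y ^ m.toAdd.2.2 : Aˣ)
  map_one' := by simp
  map_mul' m n := by
    simp only [toAdd_mul, Prod.fst_add, Prod.snd_add, pow_add, zpow_add, Units.val_mul]
    ring

lemma span_range_laurentMonomial (K : Type*) [CommRing K] [Algebra K A] {f : A} {x y : Aˣ}
    (h : Algebra.adjoin K {f, ↑x, ↑x⁻¹, ↑y, ↑y⁻¹} = ⊤) :
    Submodule.span K (Set.range (laurentMonomial f x y)) = ⊤ := by
  have adjoin_range : Algebra.adjoin K (Set.range (laurentMonomial f x y)) = ⊤ := by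
    rw [eq_top_iff, ← h]
    refine Algebra.adjoin_mono ?_
    have mem (m : ℕ × ℤ × ℤ) {a : A} (ha : laurentMonomial f x y (.ofAdd m) = a) :
        a ∈ Set.range (laurentMonomial f x y) := ⟨_, ha⟩
    simp only [Set.insert_subset_iff, Set.singleton_subset_iff]
    exact ⟨mem (1, 0, 0) (by simp [laurentMonomial]), mem (0, 1, 0) (by simp [laurentMonomial]),
      mem (0, -1, 0) (by simp [laurentMonomial]), mem (0, 0, 1) (by simp [laurentMonomial]),
      mem (0, 0, -1) (by simp [laurentMonomial])⟩
  rw [← MonoidHom.coe_mrange] at adjoin_range ⊢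
  rw [← Algebra.top_toSubmodule, ← adjoin_range, Algebra.adjoin_eq_span, Submonoid.closure_eq]

lemma IsWeightVector.laurentMonomial {K : Type u} [Field K] {M : Type*} [AddCommGroup M]
    {A : Type u} [CommRing A] [Algebra K A] {ρ : A →ₐ[K] AddMonoidAlgebra K M ⊗[K] A}
    {f : A} {x y : Aˣ} {u v w : M} (hf : IsWeightVector ρ u f) (hx : IsWeightVector ρ v x)
    (hy : IsWeightVector ρ w y) (m : Multiplicative (ℕ × ℤ × ℤ)) :
    IsWeightVector ρ (m.toAdd.1 • u + (m.toAdd.2.1 • v + m.toAdd.2.2 • w))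
      (laurentMonomial f x y m) :=
  (hf.pow _).mul ((hx.zpow _).mul (hy.zpow _))

end LaurentMonomials

section Patches

variable (K : Type u) [Field K]

/-- The ring of functions on a patch of `coneOpen`. -/
abbrev patchRing (i : Fin 2) : Type u := Localization.Away (den K i)

/-- The coordinate functions on a patch, reordered so that those with index `1` and `2` are
invertible. -/
def patchCoord (i : Fin 2) (k : Fin 4) : patchRing K i :=
  algebraMap (coneRing K) _ (coord K (patchIndex i k))

variable {K}

lemma coord_relation (i : Fin 2) : coord K (patchIndex i 0) * coord K (patchIndex i 2) =
    coord K (patchIndex i 1) * coord K (patchIndex i 3) := by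
  have h : coord K 0 * coord K 2 = coord K 1 * coord K 3 := by
    rw [coord, coord, coord, coord, ← map_mul, ← map_mul, Ideal.Quotient.eq]
    exact Ideal.subset_span rfl
  match i with
  | 0 => exact h
  | 1 => exact h.symm

lemma patchCoord_relation (i : Fin 2) :
    patchCoord K i 0 * patchCoord K i 2 = patchCoord K i 1 * patchCoord K i 3 := by
  simp only [patchCoord, ← map_mul, coord_relation]

lemma isUnit_algebraMap_den (i : Fin 2) : IsUnit (algebraMap _ (patchRing K i) (den K i)) :=
  IsLocalization.Away.algebraMap_isUnit (den K i)

lemma algebraMap_den (i : Fin 2) : algebraMap _ (patchRing K i) (den K i) =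
    patchCoord K i 1 * patchCoord K i 2 := map_mul _ _ _

lemma isUnit_patchCoord (i : Fin 2) : IsUnit (patchCoord K i 1) ∧ IsUnit (patchCoord K i 2) := by
  rw [← IsUnit.mul_iff, ← algebraMap_den]
  exact isUnit_algebraMap_den i

variable (K) in
/-- The coordinate with index `1` on a patch, as a unit. -/
def patchUnit₁ (i : Fin 2) : (patchRing K i)ˣ := (isUnit_patchCoord i).1.unit

variable (K) in
/-- The coordinate with index `2` on a patch, as a unit. -/
def patchUnit₂ (i : Fin 2) : (patchRing K i)ˣ := (isUnit_patchCoord i).2.unit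

lemma coe_patchUnit₁ (i : Fin 2) : (patchUnit₁ K i : patchRing K i) = patchCoord K i 1 := rfl

lemma coe_patchUnit₂ (i : Fin 2) : (patchUnit₂ K i : patchRing K i) = patchCoord K i 2 := rfl

lemma map_mem_of_map_coord_mem {R : Type*} [CommRing R] [Algebra K R] (φ : coneRing K →ₐ[K] R)
    {S : Subalgebra K R} (h : ∀ k, φ (coord K k) ∈ S) (a : coneRing K) : φ a ∈ S := by
  obtain ⟨q, rfl⟩ := Ideal.Quotient.mk_surjective a
  have le_comap : ⊤ ≤ S.comap (φ.comp (Ideal.Quotient.mkₐ K _)) := by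
    rw [← MvPolynomial.adjoin_range_X, Algebra.adjoin_le_iff]
    rintro _ ⟨k, rfl⟩
    exact h k
  exact le_comap Algebra.mem_top

lemma adjoin_patchCoord (i : Fin 2) : Algebra.adjoin K {patchCoord K i 0, ↑(patchUnit₁ K i),
    ↑(patchUnit₁ K i)⁻¹, ↑(patchUnit₂ K i), ↑(patchUnit₂ K i)⁻¹} = ⊤ := by
  set S := Algebra.adjoin K {patchCoord K i 0, ↑(patchUnit₁ K i), ↑(patchUnit₁ K i)⁻¹,
    ↑(patchUnit₂ K i), ↑(patchUnit₂ K i)⁻¹} with hS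
  have h₀ : patchCoord K i 0 ∈ S := Algebra.subset_adjoin (by simp)
  have h₁ : patchCoord K i 1 ∈ S := Algebra.subset_adjoin (by simp [patchUnit₁])
  have h₁' : ↑(patchUnit₁ K i)⁻¹ ∈ S := Algebra.subset_adjoin (by simp)
  have h₂ : patchCoord K i 2 ∈ S := Algebra.subset_adjoin (by simp [patchUnit₂])
  have h₂' : ↑(patchUnit₂ K i)⁻¹ ∈ S := Algebra.subset_adjoin (by simp)
  have h₃ : patchCoord K i 3 ∈ S := by
    have h : patchCoord K i 3 = ↑(patchUnit₁ K i)⁻¹ * (patchCoord K i 0 * patchCoord K i 2) :=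
      (Units.eq_inv_mul_iff_mul_eq _).2 (patchCoord_relation i).symm
    exact h ▸ mul_mem h₁' (mul_mem h₀ h₂)
  have coord_mem (k : Fin 4) : algebraMap _ (patchRing K i) (coord K k) ∈ S := by
    fin_cases i <;> fin_cases k <;> assumption
  have algebraMap_mem (a : coneRing K) : algebraMap _ (patchRing K i) a ∈ S :=
    map_mem_of_map_coord_mem (IsScalarTower.toAlgHom K (coneRing K) (patchRing K i)) coord_mem a
  refine eq_top_iff.2 fun f _ => ?_
  obtain ⟨n, a, ha⟩ := IsLocalization.Away.surj (den K i) f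
  have hf : f = algebraMap _ _ a * ↑((patchUnit₁ K i * patchUnit₂ K i) ^ n)⁻¹ := by
    rw [Units.eq_mul_inv_iff_mul_eq, ← ha, algebraMap_den]
    rfl
  rw [hf, ← inv_pow, mul_inv, Units.val_pow_eq_pow_val, Units.val_mul]
  exact mul_mem (algebraMap_mem a) (pow_mem (mul_mem h₁' h₂') n)

/-- The homomorphism from the functions on a patch determined by a point of the cone at which the
denominator is invertible. -/
def patchHom {R : Type u} [CommRing R] [Algebra K R] (i : Fin 2) (φ : coneRing K →ₐ[K] R)
    (h : IsUnit (φ (den K i))) : patchRing K i →ₐ[K] R :=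
  IsLocalization.Away.liftAlgHom (den K i) h

lemma isUnit_map_den {R : Type*} [CommRing R] [Algebra K R] {i : Fin 2} (φ : coneRing K →ₐ[K] R)
    (h₁ : IsUnit (φ (coord K (patchIndex i 1)))) (h₂ : IsUnit (φ (coord K (patchIndex i 2)))) :
    IsUnit (φ (den K i)) := by
  rw [den, map_mul]
  exact h₁.mul h₂

lemma patchHom_patchCoord {R : Type u} [CommRing R] [Algebra K R] (i : Fin 2)
    (φ : coneRing K →ₐ[K] R) (h : IsUnit (φ (den K i))) (k : Fin 4) :
    patchHom i φ h (patchCoord K i k) = φ (coord K (patchIndex i k)) :=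
  IsLocalization.Away.lift_eq (den K i) h _

variable (K) in
/-- The comorphism of the torus action, with values in the functions on a patch. -/
def coneCoaction (i : Fin 2) :
    coneRing K →ₐ[K] AddMonoidAlgebra K (ℤ × ℤ) ⊗[K] patchRing K i :=
  coneHom (fun k => AddMonoidAlgebra.single (weight k) (1 : K) ⊗ₜ[K]
    algebraMap (coneRing K) (patchRing K i) (coord K k)) (by
      simp only [Algebra.TensorProduct.tmul_mul_tmul, AddMonoidAlgebra.single_mul_single,
        ← map_mul]
      rw [show coord K 0 * coord K 2 = coord K 1 * coord K 3 from coord_relation 0]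
      rfl)

lemma coneCoaction_coord (i : Fin 2) (k : Fin 4) :
    coneCoaction K i (coord K (patchIndex i k)) =
      AddMonoidAlgebra.single (weight (patchIndex i k)) (1 : K) ⊗ₜ[K] patchCoord K i k :=
  coneHom_coord _ _ _

lemma isUnit_coneCoaction_den (i : Fin 2) : IsUnit (coneCoaction K i (den K i)) := by
  apply isUnit_map_den <;> rw [coneCoaction_coord]
  exacts [isUnit_single_tmul _ (isUnit_patchCoord i).1,
    isUnit_single_tmul _ (isUnit_patchCoord i).2]

variable (K) in
/-- The comorphism of the torus action on a patch. -/
def patchCoaction (i : Fin 2) :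
    patchRing K i →ₐ[K] AddMonoidAlgebra K (ℤ × ℤ) ⊗[K] patchRing K i :=
  patchHom i (coneCoaction K i) (isUnit_coneCoaction_den i)

lemma isWeightVector_patchCoord (i : Fin 2) (k : Fin 4) :
    IsWeightVector (patchCoaction K i) (weight (patchIndex i k)) (patchCoord K i k) := by
  rw [IsWeightVector, patchCoaction, patchHom_patchCoord, coneCoaction_coord]

variable (K) in
/-- The monomials that span the functions on a patch. -/
def patchMonomial (i : Fin 2) : Multiplicative (ℕ × ℤ × ℤ) →* patchRing K i :=
  laurentMonomial (patchCoord K i 0) (patchUnit₁ K i) (patchUnit₂ K i)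

/-- The exponents of the monomials `z₁z₂²/z₃⁴` and `z₂²z₄⁴/z₁⁵` on the two patches. -/
def ratioExp : Fin 2 → ℕ × ℤ × ℤ := ![(1, 2, -4), (2, -5, 4)]

variable (K) in
/-- The generator of the ring of invariant functions on a patch. -/
def ratio (i : Fin 2) : patchRing K i := patchMonomial K i (.ofAdd (ratioExp i))

/-- The weight of a monomial on a patch. -/
def monomialWeight (i : Fin 2) (m : ℕ × ℤ × ℤ) : ℤ × ℤ :=
  m.1 • weight (patchIndex i 0) +
    (m.2.1 • weight (patchIndex i 1) + m.2.2 • weight (patchIndex i 2))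

lemma isWeightVector_patchMonomial (i : Fin 2) (m : Multiplicative (ℕ × ℤ × ℤ)) :
    IsWeightVector (patchCoaction K i) (monomialWeight i m.toAdd) (patchMonomial K i m) := by
  refine IsWeightVector.laurentMonomial (isWeightVector_patchCoord i 0) ?_ ?_ m
  · rw [coe_patchUnit₁]
    exact isWeightVector_patchCoord i 1
  · rw [coe_patchUnit₂]
    exact isWeightVector_patchCoord i 2

lemma isWeightVector_ratio (i : Fin 2) : IsWeightVector (patchCoaction K i) 0 (ratio K i) := by
  have h : monomialWeight i (ratioExp i) = 0 := by fin_cases i <;> rfl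
  exact h ▸ isWeightVector_patchMonomial i (.ofAdd (ratioExp i))

lemma exists_eq_nsmul_ratioExp {i : Fin 2} {m : ℕ × ℤ × ℤ} (hm : monomialWeight i m = 0) :
    ∃ n : ℕ, m = n • ratioExp i := by
  obtain ⟨a, b, c⟩ := m
  match i with
  | 0 =>
    simp only [monomialWeight, weight, patchIndex, Matrix.cons_val, Prod.smul_mk, nsmul_eq_mul,
      zsmul_eq_mul, Int.cast_id, Prod.mk_add_mk, Prod.mk_eq_zero] at hm
    exact ⟨a, by simp only [ratioExp, Matrix.cons_val, Prod.smul_mk, nsmul_eq_mul, smul_eq_mul,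
      Prod.mk.injEq]; omega⟩
  | 1 =>
    simp only [monomialWeight, weight, patchIndex, Matrix.cons_val, Prod.smul_mk, nsmul_eq_mul,
      zsmul_eq_mul, Int.cast_id, Prod.mk_add_mk, Prod.mk_eq_zero] at hm
    exact ⟨a / 2, by simp only [ratioExp, Matrix.cons_val, Prod.smul_mk, nsmul_eq_mul, smul_eq_mul,
      Prod.mk.injEq]; omega⟩

theorem exists_aeval_ratio_eq {i : Fin 2} {f : patchRing K i}
    (hf : IsWeightVector (patchCoaction K i) 0 f) :
    ∃ q, Polynomial.aeval (R := K) (ratio K i) q = f := by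
  refine mem_of_isWeightVector_zero (isWeightVector_patchMonomial i)
    (span_range_laurentMonomial K (adjoin_patchCoord i))
    (N := Subalgebra.toSubmodule (Polynomial.aeval (R := K) (ratio K i)).range) ?_ hf
  intro m hm
  obtain ⟨n, hn⟩ := exists_eq_nsmul_ratioExp hm
  obtain rfl : m = .ofAdd (ratioExp i) ^ n := hn
  exact ⟨Polynomial.X ^ n, by simp [ratio]⟩

lemma ratio_zero_mul :
    ratio K 0 * patchCoord K 0 2 ^ 4 = patchCoord K 0 0 * patchCoord K 0 1 ^ 2 := by
  have h : ratio K 0 =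
      patchCoord K 0 0 ^ 1 * ↑(patchUnit₁ K 0 ^ 2 * (patchUnit₂ K 0 ^ 4)⁻¹) := rfl
  rw [h, pow_one, _root_.mul_assoc, ← coe_patchUnit₁, ← coe_patchUnit₂,
    ← Units.val_pow_eq_pow_val, ← Units.val_mul, inv_mul_cancel_right, Units.val_pow_eq_pow_val]

lemma ratio_one_mul :
    ratio K 1 * patchCoord K 1 1 ^ 5 = patchCoord K 1 0 ^ 2 * patchCoord K 1 2 ^ 4 := by
  have h : ratio K 1 =
      patchCoord K 1 0 ^ 2 * ↑((patchUnit₁ K 1 ^ 5)⁻¹ * patchUnit₂ K 1 ^ 4) := rfl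
  rw [h, _root_.mul_assoc, mul_comm (_ ^ 5)⁻¹, ← coe_patchUnit₁, ← coe_patchUnit₂,
    ← Units.val_pow_eq_pow_val, ← Units.val_mul, inv_mul_cancel_right, Units.val_pow_eq_pow_val]

lemma associated_ratio (i : Fin 2) :
    Associated (patchCoord K i 0 ^ (i.val + 1)) (ratio K i) := by
  fin_cases i <;> exact ⟨_, rfl⟩

lemma associated_den (i : Fin 2) :
    Associated (algebraMap _ (patchRing K i) (den K (i + 1))) (patchCoord K i 0 ^ 2) := by
  have h : algebraMap _ (patchRing K i) (den K (i + 1)) = patchCoord K i 0 * patchCoord K i 3 := by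
    fin_cases i <;> exact map_mul _ _ _
  refine ⟨patchUnit₁ K i * (patchUnit₂ K i)⁻¹, ?_⟩
  rw [h, Units.val_mul, ← _root_.mul_assoc, Units.mul_inv_eq_iff_eq_mul, coe_patchUnit₁,
    coe_patchUnit₂]
  linear_combination -patchCoord K i 0 * patchCoord_relation (K := K) i

/-- A slice of the torus action on a patch. -/
def slice (i : Fin 2) : patchRing K i →ₐ[K] Polynomial K :=
  patchHom i (coneHom
    (![![Polynomial.X, 1, 1, Polynomial.X], ![1, Polynomial.X, Polynomial.X, 1]] i)
    (by fin_cases i <;> simp)) (by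
      apply isUnit_map_den <;> rw [coneHom_coord] <;> fin_cases i <;> exact isUnit_one)

lemma slice_patchCoord (i : Fin 2) (k : Fin 4) : slice i (patchCoord K i k) =
    ![Polynomial.X, 1, 1, Polynomial.X] k := by
  rw [slice, patchHom_patchCoord, coneHom_coord]
  fin_cases i <;> fin_cases k <;> rfl

lemma slice_ratio (i : Fin 2) : slice i (ratio K i) = Polynomial.X ^ (i.val + 1) := by
  match i with
  | 0 => simpa [slice_patchCoord] using congr(slice 0 $(ratio_zero_mul (K := K)))
  | 1 => simpa [slice_patchCoord] using congr(slice 1 $(ratio_one_mul (K := K)))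

lemma aeval_ratio_injective (i : Fin 2) :
    Function.Injective (Polynomial.aeval (R := K) (ratio K i)) := by
  have h : (slice i).comp (Polynomial.aeval (R := K) (ratio K i)) =
      Polynomial.expand K (i.val + 1) := by
    apply Polynomial.algHom_ext
    simp [slice_ratio]
  refine Function.Injective.of_comp (f := slice i) ?_
  rw [← AlgHom.coe_comp, h]
  exact Polynomial.expand_injective (Nat.succ_pos _)

end Patches

section Gluing

variable {K : Type u} [Field K] {J : Type} {U : J → KScheme K} {X : KScheme K} (j : ∀ i, U i ⟶ X)
  [∀ i, IsOpenImmersion (j i).left]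

lemma exists_glue (hj : ∀ x, ∃ i y, (j i).left y = x) {Y : KScheme K} (f : ∀ i, U i ⟶ Y)
    (hf : ∀ i i' (W : KScheme K) (a : W ⟶ U i) (b : W ⟶ U i'), a ≫ j i = b ≫ j i' →
      a ≫ f i = b ≫ f i') : ∃ g : X ⟶ Y, ∀ i, j i ≫ g = f i := by
  let C : X.left.OpenCover :=
    Scheme.Cover.mkOfCovers J (fun i => (U i).left) (fun i => (j i).left) hj
  have hC (i i' : J) : Limits.pullback.fst (j i).left (j i').left ≫ (f i).left =
      Limits.pullback.snd (j i).left (j i').left ≫ (f i').left := by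
    let P : KScheme K := Over.mk (Limits.pullback.fst (j i).left (j i').left ≫ (U i).hom)
    let a : P ⟶ U i := Over.homMk (Limits.pullback.fst _ _) rfl
    let b : P ⟶ U i' := Over.homMk (Limits.pullback.snd _ _) (by
      change _ = Limits.pullback.fst _ _ ≫ (U i).hom
      rw [← Over.w (j i), ← Over.w (j i'), Limits.pullback.condition_assoc])
    have hab : a ≫ j i = b ≫ j i' := by
      ext1
      exact Limits.pullback.condition
    exact congr(($(hf i i' P a b hab)).left)
  let g : X.left ⟶ Y.left := C.glueMorphisms (fun i => (f i).left) hC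
  have hg (i : J) : (j i).left ≫ g = (f i).left := C.ι_glueMorphisms _ _ i
  have hw (i : J) : (j i).left ≫ g ≫ Y.hom = (j i).left ≫ X.hom := by
    rw [reassoc_of% hg, Over.w, Over.w]
  refine ⟨Over.homMk g (C.hom_ext _ _ hw), fun i => ?_⟩
  ext1
  exact hg i

lemma hom_ext_of_cover (hj : ∀ x, ∃ i y, (j i).left y = x) {Y Z : KScheme K} (s : Z ⟶ X)
    {p q : Z ⟶ Y} (h : ∀ i (W : KScheme K) (k : W ⟶ Z) (a : W ⟶ U i), k ≫ s = a ≫ j i →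
      k ≫ p = k ≫ q) : p = q := by
  ext1
  refine Scheme.hom_ext_of_forall _ _ fun z => ?_
  obtain ⟨i, y, hy⟩ := hj (s.left z)
  let V : Z.left.Opens := s.left ⁻¹ᵁ (j i).left.opensRange
  have hV : Set.range (openIncl Z V ≫ s).left ⊆ Set.range (j i).left := by
    rintro _ ⟨x, rfl⟩
    have hx : (openIncl Z V).left x ∈ (V : Set Z.left) := by
      rw [← range_openIncl]
      exact ⟨x, rfl⟩
    exact hx
  refine ⟨V, ⟨y, hy⟩, ?_⟩
  exact congr(($(h i _ (openIncl Z V) (immersionLift (j i) _ hV)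
    (immersionLift_comp (j i) _ hV).symm)).left)

end Gluing

section PullBijective

lemma pull_bijective {X Y : Scheme.{u}} (f : X ⟶ Y) [IsOpenImmersion f] {V : Y.Opens}
    (hV : Set.range f = (V : Set Y)) (e : ⊤ ≤ f ⁻¹ᵁ V) : Function.Bijective (pull f V ⊤ e) := by
  have app_isIso : IsIso (f.app V) := f.isIso_app V (by
    intro x hx
    rw [← SetLike.mem_coe, ← hV] at hx
    exact hx)
  have restriction_isIso : IsIso (homOfLE e) := ⟨homOfLE le_top, rfl, rfl⟩
  have appLE_isIso : IsIso (f.appLE V ⊤ e) := by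
    rw [Scheme.Hom.appLE]
    infer_instance
  exact ConcreteCategory.bijective_of_isIso (f.appLE V ⊤ e)

lemma top_le_preimage_top {X Y : Scheme.{u}} (f : X ⟶ Y) : ⊤ ≤ f ⁻¹ᵁ ⊤ := fun _ _ => trivial

variable (K : Type u) [Field K]

lemma pull_left_toΓ {A : Type u} [CommRing A] [Algebra K A] {W : KScheme K}
    (f : W ⟶ affineScheme K A) (a : A) :
    pull f.left ⊤ ⊤ (top_le_preimage_top _) (toΓ K A a) = comor K f a := by
  rw [comor_eq_appTop]
  exact (app_eq_pull f.left ⊤ _).symm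

instance prodToSpec_isIso (A B : Type u) [CommRing A] [CommRing B] [Algebra K A] [Algebra K B] :
    IsIso (prodToSpec K A B).left :=
  inferInstanceAs (IsIso (pullbackSpecIso K A B).hom)

lemma comor_injective_of_isIso {A : Type u} [CommRing A] [Algebra K A] {W : KScheme K}
    (f : W ⟶ affineScheme K A) [hf : IsIso f.left] : Function.Injective (comor K f) := by
  have key (g : W.left ⟶ Spec (.of A)) (_ : IsIso g) : Function.Bijective
      ((Scheme.ΓSpecIso (.of A)).inv ≫ g.appTop).hom := by
    have : IsIso g.appTop := inferInstanceAs (IsIso (g.app ⊤))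
    exact ConcreteCategory.bijective_of_isIso ((Scheme.ΓSpecIso (.of A)).inv ≫ g.appTop)
  exact (key f.left hf).1

instance quasiCompact_snd {A : Type u} [CommRing A] [Algebra K A] (X : KScheme K) :
    QuasiCompact (snd (affineScheme K A) X).left := by
  have key (f : Spec (.of A) ⟶ Spec (.of K)) : QuasiCompact (Limits.pullback.snd f X.hom) :=
    inferInstance
  exact key _

end PullBijective

section DescentOnChart

variable {X Y Z P : Scheme.{u}} {o₁ o₂ : Z ⟶ X} {p : X ⟶ Y} {j : P ⟶ X}

lemma IsEqualized.pull_pull_eq {Z' : Scheme.{u}} {k : Z' ⟶ Z} {a₁ a₂ : Z' ⟶ P}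
    (h₁ : a₁ ≫ j = k ≫ o₁) (h₂ : a₂ ≫ j = k ≫ o₂) {U : X.Opens} {f : Γ(X, U)}
    (hf : IsEqualized o₁ o₂ f) {W : P.Opens} (e : W ≤ j ⁻¹ᵁ U) {V : Z'.Opens}
    (e₁ : V ≤ a₁ ⁻¹ᵁ W) (e₂ : V ≤ a₂ ⁻¹ᵁ W) :
    pull a₁ W V e₁ (pull j U W e f) = pull a₂ W V e₂ (pull j U W e f) := by
  have e₁' : V ≤ k ⁻¹ᵁ (o₁ ⁻¹ᵁ U) := by
    rw [← Scheme.Hom.comp_preimage, ← h₁]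
    exact fun x hx => e (e₁ hx)
  have e₂' : V ≤ k ⁻¹ᵁ (o₂ ⁻¹ᵁ U) := by
    rw [← Scheme.Hom.comp_preimage, ← h₂]
    exact fun x hx => e (e₂ hx)
  have e' : V ≤ k ⁻¹ᵁ (o₁ ⁻¹ᵁ U ⊓ o₂ ⁻¹ᵁ U) := le_inf e₁' e₂'
  calc pull a₁ W V e₁ (pull j U W e f)
      = pull (k ≫ o₁) U V e₁' f := (pull_pull _ _ _ _ _).trans (pull_congr h₁ _ _ f)
    _ = pull (k ≫ o₂) U V e₂' f := by
      rw [← pull_pull k o₁ inf_le_left e', hf, pull_pull]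
    _ = pull a₂ W V e₂ (pull j U W e f) :=
      (pull_congr h₂.symm _ _ f).trans (pull_pull _ _ _ _ _).symm

lemma descendsOver_of_chart {C : Scheme.{u}} {c : C ⟶ Y} {q : P ⟶ C} (h : j ≫ p = q ≫ c)
    {V : Y.Opens} {ej : ⊤ ≤ j ⁻¹ᵁ (p ⁻¹ᵁ V)} {ec : ⊤ ≤ c ⁻¹ᵁ V}
    (hj : Function.Injective (pull j _ ⊤ ej)) (hc : Function.Bijective (pull c V ⊤ ec))
    (hq : Function.Injective (pull q ⊤ ⊤ (top_le_preimage_top q)))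
    (hf : ∀ f : Γ(X, p ⁻¹ᵁ V), IsEqualized o₁ o₂ f →
      ∃ g, pull q ⊤ ⊤ (top_le_preimage_top q) g = pull j _ ⊤ ej f) :
    DescendsOver o₁ o₂ p V := by
  have pull_comp (s : Γ(Y, V)) : pull j _ ⊤ ej (pull p V _ le_rfl s) =
      pull q ⊤ ⊤ (top_le_preimage_top q) (pull c V ⊤ ec s) := by
    rw [pull_pull, pull_pull]
    exact pull_congr h _ _ s
  refine ⟨fun s s' hs => hc.1 (hq ?_), fun f hfe => ?_⟩
  · rw [← pull_comp, ← pull_comp, hs]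
  · obtain ⟨g, hg⟩ := hf f hfe
    obtain ⟨s, rfl⟩ := hc.2 g
    exact ⟨s, hj ((pull_comp s).trans hg)⟩

end DescentOnChart

section PatchImmersions

variable (K : Type u) [Field K]

/-- A patch of `coneOpen` as a scheme. -/
abbrev patch (i : Fin 2) : KScheme K := affineScheme K (patchRing K i)

/-- The immersion of a patch into the cone. -/
def patchMap (i : Fin 2) : patch K i ⟶ cone K :=
  affineMap K (IsScalarTower.toAlgHom K (coneRing K) (patchRing K i))

instance patchMap_isOpenImmersion (i : Fin 2) : IsOpenImmersion (patchMap K i).left := by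
  have key : IsOpenImmersion (Spec.map (CommRingCat.ofHom
      (algebraMap (coneRing K) (Localization.Away (den K i))))) := inferInstance
  exact key

variable {K}

lemma comor_patchMap {i : Fin 2} {W : KScheme K} (f : W ⟶ patch K i) (a : coneRing K) :
    comor K (f ≫ patchMap K i) a = comor K f (algebraMap _ _ a) :=
  comor_comp_map K f _ a

lemma comor_patchMap_coord {i : Fin 2} {W : KScheme K} (f : W ⟶ patch K i) (k : Fin 4) :
    comor K (f ≫ patchMap K i) (coord K (patchIndex i k)) = comor K f (patchCoord K i k) :=
  comor_patchMap f _

lemma range_patchMap (i : Fin 2) : Set.range (patchMap K i).left =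
    (PrimeSpectrum.basicOpen (den K i) : Set (PrimeSpectrum (coneRing K))) :=
  PrimeSpectrum.localization_away_comap_range (Localization.Away (den K i)) (den K i)

lemma patchMap_mem_coneOpen {i : Fin 2} (x : (patch K i).left) :
    (patchMap K i).left x ∈ coneOpen K := by
  rw [mem_coneOpen_iff_exists]
  refine ⟨i, ?_⟩
  rw [← Category.id_comp (patchMap K i), comor_patchMap,
    Scheme.basicOpen_of_isUnit _ ((isUnit_algebraMap_den i).map _)]
  trivial

variable (K) in
/-- The immersion of a patch into `coneOpen`. -/
def patchIncl (i : Fin 2) : patch K i ⟶ coneSub K :=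
  immersionLift (coneIncl K) (patchMap K i) (range_subset_of_comp _ patchMap_mem_coneOpen)

lemma patchIncl_comp (i : Fin 2) : patchIncl K i ≫ coneIncl K = patchMap K i :=
  immersionLift_comp _ _ _

instance patchIncl_isOpenImmersion (i : Fin 2) : IsOpenImmersion (patchIncl K i).left := by
  have h : IsOpenImmersion ((patchIncl K i).left ≫ (coneIncl K).left) := by
    rw [← Over.comp_left, patchIncl_comp]
    infer_instance
  exact IsOpenImmersion.of_comp _ (coneIncl K).left

lemma mem_range_patchIncl_iff (i : Fin 2) (x : (coneSub K).left) :
    x ∈ Set.range (patchIncl K i).left ↔ (coneIncl K).left x ∈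
      (PrimeSpectrum.basicOpen (den K i) : Set (PrimeSpectrum (coneRing K))) := by
  have h (y : (patch K i).left) :
      (coneIncl K).left ((patchIncl K i).left y) = (patchMap K i).left y :=
    congr(($(patchIncl_comp i)).left y)
  rw [← range_patchMap]
  constructor
  · rintro ⟨y, rfl⟩
    exact ⟨y, (h y).symm⟩
  · rintro ⟨y, hy⟩
    exact ⟨y, (coneIncl K).left.isOpenEmbedding.injective ((h y).trans hy)⟩

lemma exists_patchIncl_eq (x : (coneSub K).left) :
    ∃ (i : Fin 2) (y : (patch K i).left), (patchIncl K i).left y = x := by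
  rcases coneIncl_mem x with h | h
  · exact ⟨0, (mem_range_patchIncl_iff 0 x).2 h⟩
  · exact ⟨1, (mem_range_patchIncl_iff 1 x).2 h⟩

end PatchImmersions

section QuotientMap

variable (K : Type u) [Field K]

lemma ne_add_one (i : Fin 2) : i ≠ i + 1 := by
  fin_cases i <;> decide

/-- The quotient map on a patch. -/
def patchQuot (i : Fin 2) : patch K i ⟶ affineScheme K (Polynomial K) :=
  affineMap K (Polynomial.aeval (ratio K i))

variable {K}

lemma comor_patchQuot {i : Fin 2} {W : KScheme K} (f : W ⟶ patch K i) :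
    comor K (f ≫ patchQuot K i) Polynomial.X = comor K f (ratio K i) := by
  rw [patchQuot, comor_comp_map, Polynomial.aeval_X]

lemma comor_ratio_mul_comor_ratio {W : KScheme K} (a : W ⟶ patch K 0) (b : W ⟶ patch K 1)
    (h : a ≫ patchMap K 0 = b ≫ patchMap K 1) :
    comor K a (ratio K 0) * comor K b (ratio K 1) = 1 := by
  obtain ⟨z, hz⟩ : ∃ z : Fin 4 → Γ(W.left, ⊤), ∀ k, comor K (a ≫ patchMap K 0) (coord K k) = z k :=
    ⟨_, fun _ => rfl⟩
  have ha (k : Fin 4) : comor K a (patchCoord K 0 k) = z (patchIndex 0 k) :=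
    (comor_patchMap_coord a k).symm.trans (hz _)
  have hb (k : Fin 4) : comor K b (patchCoord K 1 k) = z (patchIndex 1 k) := by
    rw [← hz, h, comor_patchMap_coord]
  have relation : z 0 * z 2 = z 1 * z 3 := by
    have h' := congr(comor K a $(patchCoord_relation (K := K) 0))
    simp only [map_mul, ha] at h'
    exact h'
  have ratio₀ : comor K a (ratio K 0) * z 2 ^ 4 = z 0 * z 1 ^ 2 := by
    have h' := congr(comor K a $(ratio_zero_mul (K := K)))
    simp only [map_mul, map_pow, ha] at h'
    exact h'
  have ratio₁ : comor K b (ratio K 1) * z 0 ^ 5 = z 1 ^ 2 * z 3 ^ 4 := by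
    have h' := congr(comor K b $(ratio_one_mul (K := K)))
    simp only [map_mul, map_pow, hb] at h'
    exact h'
  have unit₂ : IsUnit (z 2) := ha 2 ▸ (isUnit_patchCoord 0).2.map (comor K a)
  have unit₀ : IsUnit (z 0) := hb 1 ▸ (isUnit_patchCoord 1).1.map (comor K b)
  apply ((unit₂.pow 4).mul (unit₀.pow 5)).mul_left_cancel
  calc _ = comor K a (ratio K 0) * z 2 ^ 4 * (comor K b (ratio K 1) * z 0 ^ 5) := by ring
    _ = z 0 * (z 1 * z 3) ^ 4 := by rw [ratio₀, ratio₁]; ring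
    _ = _ := by rw [← relation]; ring

lemma patchQuot_comp_chart_eq {W : KScheme K} (a : W ⟶ patch K 0) (b : W ⟶ patch K 1)
    (h : a ≫ patchIncl K 0 = b ≫ patchIncl K 1) :
    a ≫ patchQuot K 0 ≫ chart K (ne_add_one 0) = b ≫ patchQuot K 1 ≫ chart K (ne_add_one 1) := by
  rw [← Category.assoc, ← Category.assoc]
  refine comp_chart_eq K (ne_add_one 0) ?_
  rw [comor_patchQuot, comor_patchQuot]
  refine comor_ratio_mul_comor_ratio a b ?_
  rw [← patchIncl_comp, ← patchIncl_comp, reassoc_of% h]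

variable (K) in
lemma exists_quotient : ∃ p : coneSub K ⟶ projectiveLine K, ∀ i,
    patchIncl K i ≫ p = patchQuot K i ≫ chart K (ne_add_one i) := by
  refine exists_glue (patchIncl K) exists_patchIncl_eq _ ?_
  rw [Fin.forall_fin_two]
  constructor <;> rw [Fin.forall_fin_two] <;> refine ⟨fun W a b h => ?_, fun W a b h => ?_⟩
  · rw [(cancel_mono _).1 h]
  · exact patchQuot_comp_chart_eq a b h
  · exact (patchQuot_comp_chart_eq b a h.symm).symm
  · rw [(cancel_mono _).1 h]

variable (K) in
/-- The quotient map `coneOpen ⟶ ℙ¹`, glued from the maps `ratio` on the patches. -/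
def quotientMap : coneSub K ⟶ projectiveLine K := (exists_quotient K).choose

lemma patchIncl_quotientMap (i : Fin 2) : patchIncl K i ≫ quotientMap K =
    patchQuot K i ≫ chart K (ne_add_one i) := (exists_quotient K).choose_spec i

lemma basicOpen_eq_of_associated {X : Scheme.{u}} {U : X.Opens} {f g : Γ(X, U)}
    (h : Associated f g) : X.basicOpen f = X.basicOpen g := by
  obtain ⟨u, rfl⟩ := h
  rw [Scheme.basicOpen_mul, Scheme.basicOpen_of_isUnit _ u.isUnit]
  exact (inf_eq_left.2 (X.basicOpen_le f)).symm

lemma basicOpen_ratio_eq_basicOpen_den {i : Fin 2} {W : KScheme K} (f : W ⟶ patch K i) :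
    W.left.basicOpen (comor K f (ratio K i)) =
      W.left.basicOpen (comor K (f ≫ patchMap K i) (den K (i + 1))) := by
  rw [comor_patchMap, ← basicOpen_eq_of_associated ((associated_ratio i).map (comor K f)),
    basicOpen_eq_of_associated ((associated_den i).map (comor K f)), map_pow, map_pow,
    Scheme.basicOpen_pow _ _ (Nat.succ_pos _), Scheme.basicOpen_pow _ _ two_pos]

lemma quotientMap_patchIncl (i : Fin 2) (y : (patch K i).left) :
    (quotientMap K).left ((patchIncl K i).left y) =
      (chart K (ne_add_one i)).left ((patchQuot K i).left y) :=
  congr(($(patchIncl_quotientMap (K := K) i)).left y)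

lemma chart_patchQuot_mem_chartOpen_iff {i : Fin 2} (y : (patch K i).left) :
    (chart K (ne_add_one i)).left ((patchQuot K i).left y) ∈ chartOpen K (i + 1) ↔
      (patchIncl K i).left y ∈ Set.range (patchIncl K (i + 1)).left := by
  have h : (patchQuot K i).left ⁻¹ᵁ (PrimeSpectrum.basicOpen Polynomial.X :
        TopologicalSpace.Opens (PrimeSpectrum (Polynomial K))) =
      (patchMap K i).left ⁻¹ᵁ (PrimeSpectrum.basicOpen (den K (i + 1)) :
        TopologicalSpace.Opens (PrimeSpectrum (coneRing K))) := by
    rw [preimage_basicOpen_comor, preimage_basicOpen_comor, ← Category.id_comp (patchQuot K i),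
      comor_patchQuot, basicOpen_ratio_eq_basicOpen_den, Category.id_comp]
  have hy : y ∈ (patchQuot K i).left ⁻¹ᵁ (PrimeSpectrum.basicOpen Polynomial.X :
        TopologicalSpace.Opens (PrimeSpectrum (Polynomial K))) ↔
      y ∈ (patchMap K i).left ⁻¹ᵁ (PrimeSpectrum.basicOpen (den K (i + 1)) :
        TopologicalSpace.Opens (PrimeSpectrum (coneRing K))) := by rw [h]
  rw [← patchIncl_comp] at hy
  exact (chart_mem_chartOpen_iff K (ne_add_one i) _).trans
    (hy.trans (mem_range_patchIncl_iff (i + 1) _).symm)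

lemma quotientMap_mem_chartOpen_iff (i : Fin 2) (x : (coneSub K).left) :
    (quotientMap K).left x ∈ chartOpen K i ↔ x ∈ Set.range (patchIncl K i).left := by
  obtain ⟨i', y, rfl⟩ := exists_patchIncl_eq x
  rw [quotientMap_patchIncl]
  obtain rfl | rfl : i = i' ∨ i = i' + 1 := by decide +revert
  · refine iff_of_true ?_ ⟨y, rfl⟩
    rw [← SetLike.mem_coe, ← range_chart K (ne_add_one i)]
    exact ⟨_, rfl⟩
  · exact chart_patchQuot_mem_chartOpen_iff y

lemma preimage_chartOpen (i : Fin 2) :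
    (quotientMap K).left ⁻¹ᵁ chartOpen K i = (patchIncl K i).left.opensRange :=
  TopologicalSpace.Opens.ext (Set.ext fun x => quotientMap_mem_chartOpen_iff i x)

lemma isAffineOpen_preimage_chartOpen (i : Fin 2) :
    IsAffineOpen ((quotientMap K).left ⁻¹ᵁ chartOpen K i) := by
  rw [preimage_chartOpen]
  have : IsAffine (patch K i).left := inferInstanceAs (IsAffine (Spec (.of (patchRing K i))))
  exact isAffineOpen_opensRange _

end QuotientMap

section Invariance

variable {K : Type u} [Field K]

variable (K) in
/-- The torus action on a patch. -/
def patchAct (i : Fin 2) : torus K ⊗ patch K i ⟶ patch K i :=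
  prodToSpec K _ _ ≫ affineMap K (patchCoaction K i)

lemma exists_patchIndex_eq (i : Fin 2) (k : Fin 4) : ∃ l, patchIndex i l = k := by
  decide +revert

lemma whiskerLeft_patchIncl_act (i : Fin 2) :
    torus K ◁ patchIncl K i ≫ act (torus K) (coneSub K) = patchAct K i ≫ patchIncl K i := by
  have h : torus K ◁ patchIncl K i = lift (fst _ _) (snd _ _ ≫ patchIncl K i) := by
    ext1 <;> simp
  have act_comp : (torus K ◁ patchIncl K i ≫ act (torus K) (coneSub K)) ≫ coneIncl K =
      (fst _ _ : torus K ⊗ patch K i ⟶ _) • (snd _ _ ≫ patchMap K i) := by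
    rw [h, ← patchIncl_comp, ← Category.assoc (snd _ _)]
    exact smul_comp_coneIncl _ _
  rw [← cancel_mono (coneIncl K), act_comp, Category.assoc, patchIncl_comp]
  apply hom_ext_cone
  intro k
  obtain ⟨k, rfl⟩ := exists_patchIndex_eq i k
  have coaction : patchCoaction K i (patchCoord K i k) = _ := isWeightVector_patchCoord i k
  rw [comor_smul, comor_patchMap_coord, comor_patchMap_coord, patchAct, comor_comp_map,
    coaction, ← comor_lift, lift_fst_snd, Category.id_comp]

lemma comor_prodToSpec_one_tmul {A B : Type u} [CommRing A] [Algebra K A] [CommRing B]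
    [Algebra K B] (b : B) : comor K (prodToSpec K A B) (1 ⊗ₜ[K] b) = comor K (snd _ _) b := by
  rw [← prodToSpec_snd]
  exact (comor_comp_map K (prodToSpec K A B) Algebra.TensorProduct.includeRight b).symm

lemma comor_patchAct_eq_comor_snd_iff {i : Fin 2} {f : patchRing K i} :
    comor K (patchAct K i) f = comor K (snd (torus K) (patch K i)) f ↔
      IsWeightVector (patchCoaction K i) 0 f := by
  rw [isWeightVector_zero_iff, patchAct, comor_comp_map, ← comor_prodToSpec_one_tmul]
  exact (comor_injective_of_isIso K
    (prodToSpec K (AddMonoidAlgebra K (ℤ × ℤ)) (patchRing K i))).eq_iff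

lemma patchAct_patchQuot (i : Fin 2) :
    patchAct K i ≫ patchQuot K i = snd _ _ ≫ patchQuot K i := by
  apply hom_ext_polynomial
  rw [comor_patchQuot, comor_patchQuot, comor_patchAct_eq_comor_snd_iff]
  exact isWeightVector_ratio i

lemma act_quotientMap : act (torus K) (coneSub K) ≫ quotientMap K = snd _ _ ≫ quotientMap K := by
  refine hom_ext_of_cover (patchIncl K) exists_patchIncl_eq (snd _ _) fun i W k a h => ?_
  have hk : k = lift (k ≫ fst _ _) a ≫ torus K ◁ patchIncl K i := by
    ext1
    · simp
    · simp [h]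
  rw [← Category.assoc k (snd _ _), h, hk]
  simp only [Category.assoc]
  rw [reassoc_of% whiskerLeft_patchIncl_act (K := K) i, patchIncl_quotientMap,
    reassoc_of% patchAct_patchQuot (K := K) i, lift_snd_assoc]

lemma pull_patchQuot (i : Fin 2) (q : Polynomial K) :
    pull (patchQuot K i).left ⊤ ⊤ (top_le_preimage_top _) (toΓ K _ q) =
      toΓ K _ (Polynomial.aeval (ratio K i) q) := by
  rw [pull_left_toΓ, patchQuot, comor_affineMap]

lemma pull_patchQuot_injective (i : Fin 2) :
    Function.Injective (pull (patchQuot K i).left ⊤ ⊤ (top_le_preimage_top _)) := by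
  intro g g' h
  obtain ⟨q, rfl⟩ := (toΓ_bijective K _).2 g
  obtain ⟨q', rfl⟩ := (toΓ_bijective K _).2 g'
  rw [pull_patchQuot, pull_patchQuot] at h
  rw [aeval_ratio_injective i ((toΓ_bijective K _).1 h)]

lemma exists_pull_patchQuot_eq {i : Fin 2} {V : (coneSub K).left.Opens}
    (e : ⊤ ≤ (patchIncl K i).left ⁻¹ᵁ V) {f : Γ((coneSub K).left, V)}
    (hf : IsEqualized (act (torus K) (coneSub K)).left (snd (torus K) (coneSub K)).left f) :
    ∃ g, pull (patchQuot K i).left ⊤ ⊤ (top_le_preimage_top _) g =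
      pull (patchIncl K i).left V ⊤ e f := by
  obtain ⟨a, ha⟩ := (toΓ_bijective K _).2 (pull (patchIncl K i).left V ⊤ e f)
  have h₁ : (patchAct K i).left ≫ (patchIncl K i).left =
      (torus K ◁ patchIncl K i).left ≫ (act (torus K) (coneSub K)).left :=
    congr(($(whiskerLeft_patchIncl_act (K := K) i)).left).symm
  have h₂ : (snd (torus K) (patch K i)).left ≫ (patchIncl K i).left =
      (torus K ◁ patchIncl K i).left ≫ (snd (torus K) (coneSub K)).left :=
    congr(($(whiskerLeft_snd (torus K) (patchIncl K i))).left).symm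
  have invariant : IsWeightVector (patchCoaction K i) 0 a := by
    rw [← comor_patchAct_eq_comor_snd_iff, ← pull_left_toΓ, ← pull_left_toΓ, ha]
    exact hf.pull_pull_eq h₁ h₂ e _ _
  obtain ⟨q, rfl⟩ := exists_aeval_ratio_eq invariant
  exact ⟨toΓ K _ q, (pull_patchQuot i q).trans ha⟩

lemma descendsOver_chartOpen (i : Fin 2) : DescendsOver (act (torus K) (coneSub K)).left
    (snd (torus K) (coneSub K)).left (quotientMap K).left (chartOpen K i) := by
  have ej : ⊤ ≤ (patchIncl K i).left ⁻¹ᵁ ((quotientMap K).left ⁻¹ᵁ chartOpen K i) := by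
    rw [preimage_chartOpen]
    exact fun x _ => ⟨x, rfl⟩
  have ec : ⊤ ≤ (chart K (ne_add_one i)).left ⁻¹ᵁ chartOpen K i := by
    intro x _
    change _ ∈ (chartOpen K i : Set (projectiveLine K).left)
    rw [← range_chart K (ne_add_one i)]
    exact ⟨x, rfl⟩
  exact descendsOver_of_chart congr(($(patchIncl_quotientMap (K := K) i)).left)
    (pull_bijective (patchIncl K i).left (by rw [preimage_chartOpen]; rfl) ej).1
    (pull_bijective (chart K (ne_add_one i)).left (range_chart K (ne_add_one i)) ec)
    (pull_patchQuot_injective i) fun f hf => exists_pull_patchQuot_eq ej hf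

variable (K) in
theorem isGoodQuotient_quotientMap : IsGoodQuotient (torus K) (quotientMap K) :=
  isGoodQuotient_of_cover act_quotientMap (chartOpen K) (iSup_chartOpen K)
    (isAffineOpen_chartOpen K) isAffineOpen_preimage_chartOpen descendsOver_chartOpen

end Invariance

section Orbits

variable {K : Type u} [Field K]

lemma torusHom_weight (t₁ t₂ : Kˣ) (k : Fin 4) :
    torusHom t₁ t₂ (AddMonoidAlgebra.single (weight k) 1) =
      ![(t₁ : K) ^ 2, t₁ * t₂ ^ 2, t₁ * t₂, t₁ ^ 2 * (t₂ : K)⁻¹] k := by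
  rw [torusHom_single]
  fin_cases k <;> simp [weight]

lemma exists_torusHom_mul_eq_patch_zero {z : Fin 4 → K} (relation : z 0 * z 2 = z 1 * z 3)
    (h₁ : z 1 ≠ 0) (h₂ : z 2 ≠ 0) {d : K} (ratio : d * z 2 ^ 4 = z 0 * z 1 ^ 2) :
    ∃ t₁ t₂ : Kˣ, ∀ k, torusHom t₁ t₂ (AddMonoidAlgebra.single (weight (patchIndex 0 k)) 1) *
      ![d, 1, 1, d] k = z k := by
  refine ⟨Units.mk0 (z 2 ^ 2 / z 1) (div_ne_zero (pow_ne_zero 2 h₂) h₁),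
    Units.mk0 (z 1 / z 2) (div_ne_zero h₁ h₂), fun k => ?_⟩
  rw [torusHom_weight]
  fin_cases k <;> simp only [patchIndex, Units.val_mk0, Fin.zero_eta, Fin.mk_one, Fin.reduceFinMk,
    Matrix.cons_val] <;> field_simp
  · linear_combination ratio
  · linear_combination z 2 * ratio + z 1 ^ 2 * relation

lemma exists_sq_eq_and_mul_eq [IsAlgClosed K] {a b c : K} (h : b ^ 2 * a = c ^ 2) :
    ∃ r, r ^ 2 = a ∧ r * b = c := by
  obtain ⟨r, rfl⟩ := IsAlgClosed.exists_pow_nat_eq a two_pos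
  rcases sq_eq_sq_iff_eq_or_eq_neg.1 ((mul_pow r b 2).trans ((mul_comm _ _).trans h)) with h | h
  · exact ⟨r, rfl, h⟩
  · exact ⟨-r, neg_sq r, by rw [neg_mul, h, neg_neg]⟩

lemma exists_torusHom_mul_eq_patch_one [IsAlgClosed K] {z : Fin 4 → K}
    (relation : z 0 * z 2 = z 1 * z 3) (h₁ : z 1 ≠ 0) (h₂ : z 2 ≠ 0) {d : K}
    (ratio : d ^ 2 * z 1 ^ 5 = z 0 ^ 2 * z 2 ^ 4) :
    ∃ t₁ t₂ : Kˣ, ∀ k, torusHom t₁ t₂ (AddMonoidAlgebra.single (weight (patchIndex 1 k)) 1) *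
      ![d, 1, 1, d] k = z k := by
  obtain ⟨r, hr, hr'⟩ : ∃ r, r ^ 2 = z 1 ∧ r * ((z 1 / z 2) ^ 2 * d) = z 0 := by
    apply exists_sq_eq_and_mul_eq
    field_simp
    linear_combination ratio
  have r_ne : r ≠ 0 := by
    rintro rfl
    exact h₁ (by rw [← hr, zero_pow two_ne_zero])
  refine ⟨Units.mk0 r r_ne, Units.mk0 (z 1 / z 2) (div_ne_zero h₁ h₂), fun k => ?_⟩
  rw [torusHom_weight]
  fin_cases k <;> simp only [patchIndex, Units.val_mk0, Fin.zero_eta, Fin.mk_one, Fin.reduceFinMk,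
    Matrix.cons_val]
  · rw [← hr', _root_.mul_assoc]
  · exact (_root_.mul_one _).trans hr
  · rw [hr]
    field_simp
  · field_simp at hr' ⊢
    exact mul_left_cancel₀ h₁ (by linear_combination hr' + z 2 * relation)

lemma exists_torusHom_mul_eq [IsAlgClosed K] (i : Fin 2) {d : K} {φ : patchRing K i →ₐ[K] K}
    (h : φ (ratio K i) = d ^ (i.val + 1)) :
    ∃ t₁ t₂ : Kˣ, ∀ k, torusHom t₁ t₂ (AddMonoidAlgebra.single (weight (patchIndex i k)) 1) *
      ![d, 1, 1, d] k = φ (patchCoord K i k) := by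
  have relation := congr(φ $(patchCoord_relation (K := K) i))
  rw [map_mul, map_mul] at relation
  have h₁ := ((isUnit_patchCoord i).1.map φ).ne_zero
  have h₂ := ((isUnit_patchCoord i).2.map φ).ne_zero
  match i with
  | 0 =>
    have h_ratio := congr(φ $(ratio_zero_mul (K := K)))
    simp only [map_mul, map_pow, h, Fin.val_zero, zero_add, pow_one] at h_ratio
    exact exists_torusHom_mul_eq_patch_zero relation h₁ h₂ h_ratio
  | 1 =>
    have h_ratio := congr(φ $(ratio_one_mul (K := K)))
    simp only [map_mul, map_pow, h] at h_ratio
    exact exists_torusHom_mul_eq_patch_one relation h₁ h₂ h_ratio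

theorem exists_patch_point [IsAlgClosed K] (i : Fin 2) (c : K) :
    ∃ φ₀ : patchRing K i →ₐ[K] K, φ₀ (ratio K i) = c ∧ ∀ φ : patchRing K i →ₐ[K] K,
      φ (ratio K i) = c → ∃ t₁ t₂ : Kˣ, ∀ k,
        torusHom t₁ t₂ (AddMonoidAlgebra.single (weight (patchIndex i k)) 1) *
          φ₀ (patchCoord K i k) = φ (patchCoord K i k) := by
  obtain ⟨d, rfl⟩ := IsAlgClosed.exists_pow_nat_eq c (Nat.succ_pos i.val)
  refine ⟨(Polynomial.aeval d).comp (slice i), ?_, fun φ hφ => ?_⟩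
  · rw [AlgHom.comp_apply, slice_ratio, map_pow, Polynomial.aeval_X]
  · obtain ⟨t₁, t₂, ht⟩ := exists_torusHom_mul_eq i hφ
    refine ⟨t₁, t₂, fun k => ?_⟩
    rw [← ht, AlgHom.comp_apply, slice_patchCoord]
    fin_cases k <;> simp

end Orbits

section Fibres

variable {K : Type u} [Field K]

lemma exists_affineMap_comp_eq {A : Type u} [CommRing A] [Algebra K A] {X : KScheme K}
    (j : affineScheme K A ⟶ X) [IsOpenImmersion j.left] (x : affineScheme K K ⟶ X)
    (h : ∃ s, x.left s ∈ Set.range j.left) : ∃ φ : A →ₐ[K] K, affineMap K φ ≫ j = x := by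
  have range_subset : Set.range x.left ⊆ Set.range j.left := by
    rintro _ ⟨s, rfl⟩
    have : Subsingleton (affineScheme K K).left := inferInstanceAs (Subsingleton (PrimeSpectrum K))
    obtain ⟨s', hs'⟩ := h
    rwa [Subsingleton.elim s s']
  obtain ⟨φ, hφ⟩ := exists_affineMap_eq K (immersionLift j x range_subset)
  exact ⟨φ, by rw [← hφ, immersionLift_comp]⟩

lemma smul_quotientMap {W : KScheme K} (g : W ⟶ torus K) (x : W ⟶ coneSub K) :
    (g • x) ≫ quotientMap K = x ≫ quotientMap K := by
  have h := congr(lift g x ≫ $(act_quotientMap (K := K)))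
  rw [lift_snd_assoc, ← Category.assoc] at h
  exact h

lemma affineMap_patchIncl_quotientMap_eq_iff {i : Fin 2} {φ : patchRing K i →ₐ[K] K}
    {ψ : Polynomial K →ₐ[K] K} :
    (affineMap K φ ≫ patchIncl K i) ≫ quotientMap K = affineMap K ψ ≫ chart K (ne_add_one i) ↔
      φ (ratio K i) = ψ Polynomial.X := by
  rw [Category.assoc, patchIncl_quotientMap, ← Category.assoc, cancel_mono, patchQuot,
    affineMap_comp, affineMap_inj, Polynomial.algHom_ext_iff, AlgHom.comp_apply,
    Polynomial.aeval_X]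

lemma affineMap_smul_patchIncl {i : Fin 2} {θ : AddMonoidAlgebra K (ℤ × ℤ) →ₐ[K] K}
    {φ ψ : patchRing K i →ₐ[K] K}
    (h : ∀ k, θ (AddMonoidAlgebra.single (weight (patchIndex i k)) 1) * φ (patchCoord K i k) =
      ψ (patchCoord K i k)) :
    affineMap K θ • (affineMap K φ ≫ patchIncl K i) = affineMap K ψ ≫ patchIncl K i := by
  rw [← cancel_mono (coneIncl K), smul_comp_coneIncl, Category.assoc, Category.assoc,
    patchIncl_comp, patchMap, affineMap_comp, affineMap_comp]
  refine affineMap_smul_affineMap θ fun k => ?_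
  obtain ⟨k, rfl⟩ := exists_patchIndex_eq i k
  exact h k

lemma exists_affineMap_comp_chart_eq (y : affineScheme K K ⟶ projectiveLine K) :
    ∃ (i : Fin 2) (ψ : Polynomial K →ₐ[K] K), affineMap K ψ ≫ chart K (ne_add_one i) = y := by
  let s : (affineScheme K K).left := (⊥ : PrimeSpectrum K)
  have hs : y.left s ∈ ⨆ i, chartOpen K i := by rw [iSup_chartOpen]; trivial
  obtain ⟨i, hi⟩ := TopologicalSpace.Opens.mem_iSup.1 hs
  exact ⟨i, exists_affineMap_comp_eq _ y ⟨s, by rwa [range_chart]⟩⟩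

lemma exists_affineMap_comp_patchIncl_eq {i : Fin 2} {ψ : Polynomial K →ₐ[K] K}
    {x : affineScheme K K ⟶ coneSub K}
    (hx : x ≫ quotientMap K = affineMap K ψ ≫ chart K (ne_add_one i)) :
    ∃ φ : patchRing K i →ₐ[K] K, affineMap K φ ≫ patchIncl K i = x := by
  let s : (affineScheme K K).left := (⊥ : PrimeSpectrum K)
  refine exists_affineMap_comp_eq _ x ⟨s, ?_⟩
  rw [← quotientMap_mem_chartOpen_iff, ← SetLike.mem_coe, ← range_chart K (ne_add_one i)]
  exact ⟨(affineMap K ψ).left s, congr(($hx).left s).symm⟩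

theorem exists_fibre_eq_orbit [IsAlgClosed K] (y : affineScheme K K ⟶ projectiveLine K) :
    ∃ x : affineScheme K K ⟶ coneSub K, ∀ x' : affineScheme K K ⟶ coneSub K,
      x' ≫ quotientMap K = y ↔ ∃ g : affineScheme K K ⟶ torus K, x' = g • x := by
  obtain ⟨i, ψ, rfl⟩ := exists_affineMap_comp_chart_eq y
  obtain ⟨φ₀, hφ₀, orbit⟩ := exists_patch_point i (ψ Polynomial.X)
  refine ⟨affineMap K φ₀ ≫ patchIncl K i, fun x' => ⟨fun hx' => ?_, ?_⟩⟩
  · obtain ⟨φ, rfl⟩ := exists_affineMap_comp_patchIncl_eq hx'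
    obtain ⟨t₁, t₂, ht⟩ := orbit φ (affineMap_patchIncl_quotientMap_eq_iff.1 hx')
    exact ⟨affineMap K (torusHom t₁ t₂), (affineMap_smul_patchIncl ht).symm⟩
  · rintro ⟨g, rfl⟩
    rw [smul_quotientMap, affineMap_patchIncl_quotientMap_eq_iff, hφ₀]

lemma exists_fibre_eq_orbit_of_iso {G X Y P Q : KScheme K} [MonObj G] [ModObj G X] {p : X ⟶ Y}
    (e : P ≅ Q)
    (h : ∀ y : Q ⟶ Y, ∃ x : Q ⟶ X, ∀ x', x' ≫ p = y ↔ ∃ g : Q ⟶ G, x' = g • x) (y : P ⟶ Y) :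
    ∃ x : P ⟶ X, ∀ x', x' ≫ p = y ↔ ∃ g : P ⟶ G, x' = g • x := by
  obtain ⟨x, hx⟩ := h (e.inv ≫ y)
  refine ⟨e.hom ≫ x, fun x' => ?_⟩
  rw [← cancel_epi e.inv, ← Category.assoc, hx]
  constructor
  · rintro ⟨g, hg⟩
    exact ⟨e.hom ≫ g, by rw [← ModObj.comp_smul, ← hg, e.hom_inv_id_assoc]⟩
  · rintro ⟨g, rfl⟩
    exact ⟨e.inv ≫ g, by rw [ModObj.comp_smul, e.inv_hom_id_assoc]⟩

variable (K) in
theorem isGeometricQuotient_quotientMap [IsAlgClosed K] :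
    IsGeometricQuotient (torus K) (quotientMap K) where
  toIsGoodQuotient := isGoodQuotient_quotientMap K
  fibre_eq_orbit := by
    have e : 𝟙_ (KScheme K) ≅ affineScheme K K :=
      ⟨toSpec K _, toUnit _, toUnit_unique _ _, hom_toSpec_unique K _ _⟩
    exact exists_fibre_eq_orbit_of_iso e exists_fibre_eq_orbit

end Fibres

end ConeGIT

end

theorem proposition3p6_general (K : Type u) [Field K] [IsAlgClosed K]
    (hK : ∃ q : Kˣ, ¬ IsOfFinOrder q) :
    (∃ _ : ModObj (torus K) (openSub (cone K) (coneOpen K)),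
      IsModHom (torus K) (openIncl (cone K) (coneOpen K)) ∧
        ∃ (Y : KScheme K) (p : openSub (cone K) (coneOpen K) ⟶ Y),
          IsGeometricQuotient (torus K) p ∧ Nonempty (Y ≅ projectiveLine K)) ∧
    ¬ ∃ L : LinearizedLineBundle (torus K) (cone K),
      L.semistableLocus = (coneOpen K : Set (cone K).left) :=
  ⟨⟨subAction K, coneIncl_isModHom K, projectiveLine K, quotientMap K,
    isGeometricQuotient_quotientMap K, ⟨Iso.refl _⟩⟩,
    fun ⟨L, hL⟩ => hK.elim fun _ hq => semistableLocus_ne_coneOpen hq L hL⟩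

theorem proposition3p6 (K : Type u) [Field K] [IsAlgClosed K] [CharZero K] :
    (∃ _ : ModObj (torus K) (openSub (cone K) (coneOpen K)),
      IsModHom (torus K) (openIncl (cone K) (coneOpen K)) ∧
        ∃ (Y : KScheme K) (p : openSub (cone K) (coneOpen K) ⟶ Y),
          IsGeometricQuotient (torus K) p ∧ Nonempty (Y ≅ projectiveLine K)) ∧
    ¬ ∃ L : LinearizedLineBundle (torus K) (cone K),
      L.semistableLocus = (coneOpen K : Set (cone K).left) :=
  proposition3p6_general K (exists_unit_not_isOfFinOrder K)
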